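/- Let $k$ be a field of characteristic $0$, $\mathcal A$ a commutative $k$-algebra, $\Xi$ (gauge parameters) a $k$-vector space and $\Phi$ (fields) an $\mathcal A$-module. Let $\Lambda^*_R M$ denote the symmetric coalgebra of an $R$-module $M$, with $\Delta(x_1\wedge\cdots\wedge x_n)=\sum(x_{\sigma(1)}\wedge\cdots\wedge x_{\sigma(p)})\otimes(x_{\sigma(p+1)}\wedge\cdots\wedge x_{\sigma(n)})$ (sum over all unshuffles, $0\le p\le n$) and with its commutative product $m$ written $\wedge$. For $f:\Lambda^*_RM\to M$ put $\bar f=m\circ(f\otimes 1)\circ\Delta$ and $[f,g]=f\circ\bar g-g\circ\bar f$. An $\mathcal A$-linear map on $\Lambda^*_{\mathcal A}\Phi$ is also regarded as a $k$-linear map on $\Lambda^*_k\Phi$, with the same values on all $\varphi_1\wedge\cdots\wedge\varphi_n$. Let $\delta:\Xi\to \mathrm{Hom}_{\mathcal A}(\Lambda^*_{\mathcal A}\Phi,\Phi)$ be $k$-linear, and extend it to $$\hat\delta:\mathrm{Hom}_k(\Lambda^*_k\Phi,\Xi)\to\mathrm{Hom}_k(\Lambda^*_k\Phi,\Phi),\qquad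 \hat\delta(\pi)(\varphi_1\wedge\cdots\wedge\varphi_n)=\sum_{\text{unshuffles}}\delta\bigl(\pi(\varphi_{\sigma(1)}\wedge\cdots\wedge\varphi_{\sigma(p)})\bigr)(\varphi_{\sigma(p+1)}\wedge\cdots\wedge\varphi_{\sigma(n)}).$$ Let $C:\Xi\otimes_k\Xi\to\mathrm{Hom}_k(\Lambda^*_k\Phi,\Xi)$ be $k$-linear and satisfy the BBvD hypothesis $[\delta(\xi),\delta(\eta)]=\hat\delta(C(\xi,\eta))$ for all $\xi,\eta\in\Xi$. Assume that $\hat\delta$ is injective. Let $\mathbb L$ be the graded vector space with $\Xi$ in degree $0$, $\Phi$ in degree $1$ and $0$ in all other degrees, with differential $\partial(\xi)=\delta(\xi)(1)$, $\partial(\varphi)=0$. Let $\downarrow\mathbb L$ be its desuspension, $(\downarrow\mathbb L)_n=\mathbb L_{n+1}$, and $\Lambda^*(\downarrow\mathbb L)$ the graded symmetric coalgebra over $k$ (with Koszul signs; $\Xi$ sits in degree $-1$, $\Phi$ in degree $0$). Then there is exactly one $k$-linear map $D:\Lambda^*(\downarrow\mathbb L)\to\downarrow\mathbb L$ with $$D(\xi)=\partial(\xi),\qquad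 D(\xi\wedge\varphi_1\wedge\cdots\wedge\varphi_n)=\delta(\xi)(\varphi_1\wedge\cdots\wedge\varphi_n)\ (n\ge 1),$$ $$D(\xi_1\wedge\xi_2\wedge\varphi_1\wedge\cdots\wedge\varphi_n)=C(\xi_1,\xi_2)(\varphi_1\wedge\cdots\wedge\varphi_n)\ (n\ge 0),$$ and $D=0$ on wedge products with no entry or with more than two entries from $\Xi$. This $D$ makes $(\mathbb L,\partial)$ an sh-Lie ($L_\infty$) algebra: $\partial$ is a differential of degree $+1$, $D$ has degree $+1$, vanishes on scalars and restricts to $\partial$ on $\downarrow\mathbb L$, and $D\circ\bar D=0$, where $\bar D=m\circ(D\otimes 1)\circ\Delta$ is the coderivation of $\Lambda^*(\downarrow\mathbb L)$ given by $D$. -/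

import Mathlib

open scoped TensorProduct DirectSum

noncomputable section

namespace ShLie

/-! ### The coalgebra of an ungraded module and the Gerstenhaber bracket

For a module `M` the coalgebra `Λ*M` is `SymmetricAlgebra R M` with Mathlib's comultiplication
`Δ` (the `x ∈ M` are primitive, so `Δ (x₁ ⋯ xₙ)` is the sum over all unshuffles). The product of
`SymmetricAlgebra R M` is the wedge product `∧`. -/

section Ungraded

variable {R M : Type*} [CommRing R] [AddCommGroup M] [Module R M]

/-- The coderivation `f̄ = m ∘ (f ⊗ 1) ∘ Δ` of `Λ*M` that belongs to `f : Λ*M → M`. -/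
def coder (f : SymmetricAlgebra R M →ₗ[R] M) :
    SymmetricAlgebra R M →ₗ[R] SymmetricAlgebra R M :=
  LinearMap.mul' R (SymmetricAlgebra R M) ∘ₗ
    TensorProduct.map (SymmetricAlgebra.ι R M ∘ₗ f) LinearMap.id ∘ₗ
    Coalgebra.comul

/-- The Gerstenhaber bracket `[f, g] = f ∘ ḡ - g ∘ f̄` on `Hom(Λ*M, M)`. -/
def gerstenhaber (f g : SymmetricAlgebra R M →ₗ[R] M) : SymmetricAlgebra R M →ₗ[R] M :=
  f ∘ₗ coder g - g ∘ₗ coder f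

end Ungraded

/-! ### Field dependent gauge transformations and the BBvD hypothesis

The maps `δ(ξ) : Λ*Φ → Φ` are `A`-linear, on `Λ*Φ` over `A`. A map `π : Λ*Φ → Ξ` is only `k`-linear
and so is `δ`; the sum over unshuffles that defines `δ̂(π)` is then symmetric and `k`-multilinear in
`φ₁, …, φₙ` but in general not balanced over `A`. So `k`-linear maps are taken on `Λ*Φ` over `k`,
to which `A`-linear maps on `Λ*Φ` over `A` are pulled back. Both agree for `A = k`. -/

section Gauge

variable {k A Ξ Φ : Type*} [Field k] [CommRing A] [Algebra k A]
  [AddCommGroup Ξ] [Module k Ξ]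
  [AddCommGroup Φ] [Module k Φ] [Module A Φ] [IsScalarTower k A Φ]

variable (k A Φ) in
/-- The canonical map from `Λ*Φ` over `k` to `Λ*Φ` over `A`,
`φ₁ ∧ ⋯ ∧ φₙ ↦ φ₁ ∧ ⋯ ∧ φₙ`. It is the identity if `A = k`. -/
def changeBase : SymmetricAlgebra k Φ →ₐ[k] SymmetricAlgebra A Φ :=
  SymmetricAlgebra.lift ((SymmetricAlgebra.ι A Φ).restrictScalars k)

/-- An `A`-linear map `Λ*Φ → Φ`, regarded as the `k`-linear map with the same values on all
`φ₁ ∧ ⋯ ∧ φₙ`. -/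
def toBase : (SymmetricAlgebra A Φ →ₗ[A] Φ) →ₗ[k] (SymmetricAlgebra k Φ →ₗ[k] Φ) where
  toFun f := f.restrictScalars k ∘ₗ (changeBase k A Φ).toLinearMap
  map_add' _ _ := rfl
  map_smul' _ _ := rfl

/-- The extension `δ̂` of `δ` to the `k`-linear maps `π : Λ*Φ → Ξ`, given by
`δ̂(π) = ev ∘ ((δ ∘ π) ⊗ 1) ∘ Δ`, that is,
`δ̂(π)(φ₁ ∧ ⋯ ∧ φₙ) = ∑ δ(π(φ_{σ(1)} ∧ ⋯ ∧ φ_{σ(p)}))(φ_{σ(p+1)} ∧ ⋯ ∧ φ_{σ(n)})`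
over all unshuffles. -/
def hatDelta (δ : Ξ →ₗ[k] (SymmetricAlgebra A Φ →ₗ[A] Φ)) :
    (SymmetricAlgebra k Φ →ₗ[k] Ξ) →ₗ[k] (SymmetricAlgebra k Φ →ₗ[k] Φ) where
  toFun π := TensorProduct.lift ((toBase ∘ₗ δ) ∘ₗ π) ∘ₗ Coalgebra.comul
  map_add' π₁ π₂ := by
    rw [LinearMap.comp_add, ← LinearMap.add_comp]
    congr 1
    exact TensorProduct.ext' fun x y => by simp
  map_smul' c π := by
    rw [RingHom.id_apply, ← LinearMap.smul_comp]
    congr 1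
    exact TensorProduct.ext' fun x y => by simp

/-- The BBvD hypothesis: `[δ(ξ), δ(η)] = δ̂(C(ξ, η))` for all gauge parameters `ξ, η`. -/
def BBvD (δ : Ξ →ₗ[k] (SymmetricAlgebra A Φ →ₗ[A] Φ))
    (C : Ξ →ₗ[k] Ξ →ₗ[k] (SymmetricAlgebra k Φ →ₗ[k] Ξ)) : Prop :=
  ∀ ξ η : Ξ, toBase (gerstenhaber (δ ξ) (δ η)) = hatDelta δ (C ξ η)

end Gauge

/-! ### The graded symmetric coalgebra of a graded module -/

section Graded

variable {k M : Type*} [CommRing k] [AddCommGroup M] [Module k M]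

variable (k) in
/-- The Koszul sign `(-1)^(ij)`, as a scalar. -/
def koszul (i j : ℤ) : k := (((i * j).negOnePow : ℤˣ) : ℤ)

theorem koszul_comm (i j : ℤ) : koszul k i j = koszul k j i := by
  rw [koszul, koszul, mul_comm]

theorem koszul_mul_self (i j : ℤ) : koszul k i j * koszul k i j = 1 := by
  rw [koszul, ← Int.cast_mul, ← Units.val_mul, Int.units_mul_self, Units.val_one, Int.cast_one]

/-- The relations `x ∧ y = (-1)^(|x||y|) y ∧ x` for homogeneous `x`, `y`. -/
inductive GradedSymRel (V : ℤ → Submodule k M) : TensorAlgebra k M → TensorAlgebra k M → Prop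
  | swap {i j : ℤ} {x y : M} (hx : x ∈ V i) (hy : y ∈ V j) :
      GradedSymRel V (TensorAlgebra.ι k x * TensorAlgebra.ι k y)
        (koszul k i j • (TensorAlgebra.ι k y * TensorAlgebra.ι k x))

/-- `Λ*V`, the module of graded symmetric tensors on the graded module `V` (with total space
`M`), with its wedge product. -/
abbrev GradedSym (V : ℤ → Submodule k M) : Type _ := RingQuot (GradedSymRel V)

namespace GradedSym

variable (V : ℤ → Submodule k M)

/-- The inclusion `V → Λ*V`. -/
def ι : M →ₗ[k] GradedSym V :=
  (RingQuot.mkAlgHom k (GradedSymRel V)).toLinearMap ∘ₗ TensorAlgebra.ι k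

variable {V}

theorem ι_mul_ι {i j : ℤ} {x y : M} (hx : x ∈ V i) (hy : y ∈ V j) :
    ι V x * ι V y = koszul k i j • (ι V y * ι V x) := by
  have h := RingQuot.mkAlgHom_rel k (GradedSymRel.swap hx hy)
  simpa [ι] using h

/-- The universal property of `Λ*V` as a graded commutative algebra. -/
def lift {B : Type*} [Semiring B] [Algebra k B] (f : M →ₗ[k] B)
    (hf : ∀ (i j : ℤ) (x y : M), x ∈ V i → y ∈ V j →
      f x * f y = koszul k i j • (f y * f x)) : GradedSym V →ₐ[k] B :=
  RingQuot.liftAlgHom k ⟨TensorAlgebra.lift k f, by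
    rintro _ _ ⟨hx, hy⟩
    simpa using hf _ _ _ _ hx hy⟩

@[simp]
theorem lift_ι {B : Type*} [Semiring B] [Algebra k B] (f : M →ₗ[k] B)
    (hf : ∀ (i j : ℤ) (x y : M), x ∈ V i → y ∈ V j →
      f x * f y = koszul k i j • (f y * f x)) (x : M) : lift f hf (ι V x) = f x := by
  simp [lift, ι]

theorem algHom_ext {B : Type*} [Semiring B] [Algebra k B] {f g : GradedSym V →ₐ[k] B}
    (h : f.toLinearMap ∘ₗ ι V = g.toLinearMap ∘ₗ ι V) : f = g := by
  apply RingQuot.ringQuot_ext'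
  apply TensorAlgebra.hom_ext
  exact h

variable (V)

/-- The part of `Λ*V` of degree `n`, spanned by the wedge products of homogeneous elements whose
degrees add up to `n`. -/
def degreePart (n : ℤ) : Submodule k (GradedSym V) :=
  Submodule.span k {z | ∃ l : List (ℤ × M), (∀ p ∈ l, p.2 ∈ V p.1) ∧
    (l.map Prod.fst).sum = n ∧ z = (l.map fun p => ι V p.2).prod}

variable [DirectSum.Decomposition V]

/-- The linear map on `V` that multiplies elements of degree `j` by `(-1)^(ij)`. -/
def signMap (i : ℤ) : M →ₗ[k] M :=
  DirectSum.toModule k ℤ M (fun j => koszul k i j • (V j).subtype) ∘ₗ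
    (DirectSum.decomposeLinearEquiv V).toLinearMap

variable {V} in
theorem signMap_of_mem (i : ℤ) {j : ℤ} {x : M} (hx : x ∈ V j) :
    signMap V i x = koszul k i j • x := by
  lift x to V j using hx
  rw [signMap, LinearMap.comp_apply, LinearEquiv.coe_coe,
    DirectSum.decomposeLinearEquiv_apply_coe, DirectSum.toModule_lof]
  simp

/-- The algebra automorphism of `Λ*V` that multiplies elements of degree `j` by `(-1)^(ij)`: the
Koszul sign for moving an element of degree `i` past its argument. -/
def signHom (i : ℤ) : GradedSym V →ₐ[k] GradedSym V :=
  lift (ι V ∘ₗ signMap V i) (by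
    intro p q x y hx hy
    simp only [LinearMap.comp_apply, signMap_of_mem i hx, signMap_of_mem i hy,
      map_smul, smul_mul_assoc, mul_smul_comm, ι_mul_ι hx hy, smul_smul]
    congr 1
    ring)

variable {V} in
theorem signHom_ι (i : ℤ) {j : ℤ} {x : M} (hx : x ∈ V j) :
    signHom V i (ι V x) = koszul k i j • ι V x := by
  rw [signHom, lift_ι, LinearMap.comp_apply, signMap_of_mem i hx, map_smul]

/-- Left multiplication by `1 ⊗ x` on `Λ*V ⊗ Λ*V` for `x` of degree `i`:
`(1 ⊗ x)(a ⊗ b) = (-1)^(i|a|) a ⊗ (x ∧ b)`. -/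
def rightMul (i : ℤ) : M →ₗ[k] Module.End k (GradedSym V ⊗[k] GradedSym V) :=
  TensorProduct.mapBilinear (RingHom.id k) (GradedSym V) (GradedSym V) (GradedSym V) (GradedSym V)
    (signHom V i).toLinearMap ∘ₗ LinearMap.mul k (GradedSym V) ∘ₗ ι V

/-- Multiplication by `x ⊗ 1 + 1 ⊗ x` from the left on `Λ*V ⊗ Λ*V`, for arbitrary `x`. -/
def primMul : M →ₗ[k] Module.End k (GradedSym V ⊗[k] GradedSym V) :=
  LinearMap.rTensorHom (GradedSym V) ∘ₗ LinearMap.mul k (GradedSym V) ∘ₗ ι V +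
    DirectSum.toModule k ℤ _ (fun i => rightMul V i ∘ₗ (V i).subtype) ∘ₗ
      (DirectSum.decomposeLinearEquiv V).toLinearMap

variable {V} in
theorem primMul_tmul {i : ℤ} {x : M} (hx : x ∈ V i) (a b : GradedSym V) :
    primMul V x (a ⊗ₜ b) = (ι V x * a) ⊗ₜ b + signHom V i a ⊗ₜ (ι V x * b) := by
  lift x to V i using hx
  simp only [primMul, LinearMap.add_apply, LinearMap.comp_apply, LinearEquiv.coe_coe,
    DirectSum.decomposeLinearEquiv_apply_coe, DirectSum.toModule_lof]
  simp [rightMul]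

variable {V} in
theorem signHom_comm (i j : ℤ) (a : GradedSym V) :
    signHom V i (signHom V j a) = signHom V j (signHom V i a) := by
  have h : (signHom V i).comp (signHom V j) = (signHom V j).comp (signHom V i) := by
    refine algHom_ext (LinearMap.ext fun x => ?_)
    simp only [LinearMap.comp_apply, AlgHom.toLinearMap_apply, AlgHom.comp_apply]
    refine DirectSum.Decomposition.inductionOn V (by simp) ?_ ?_ x
    · rintro p ⟨x, hx⟩
      simp only [signHom_ι _ hx, map_smul, smul_smul, mul_comm]
    · intro x y hx hy
      simp only [map_add, hx, hy]
  exact DFunLike.congr_fun h a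

/-- The left action of the algebra `Λ*V` on `Λ*V ⊗ Λ*V` through the comultiplication. -/
def comulAction : GradedSym V →ₐ[k] Module.End k (GradedSym V ⊗[k] GradedSym V) :=
  lift (B := Module.End k (GradedSym V ⊗[k] GradedSym V)) (primMul V) (by
    intro i j x y hx hy
    refine TensorProduct.ext' fun a b => ?_
    simp only [Module.End.mul_apply, primMul_tmul hx, primMul_tmul hy, map_add,
      LinearMap.smul_apply, map_mul, signHom_ι _ hx, signHom_ι _ hy, smul_add, ← mul_assoc,
      signHom_comm j i, ι_mul_ι hx hy, koszul_comm j i, smul_mul_assoc,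
      ← TensorProduct.smul_tmul', TensorProduct.tmul_smul, smul_smul, koszul_mul_self, one_smul]
    abel)

/-- The comultiplication `Δ` of the coalgebra `Λ*V`: the algebra homomorphism into the graded
tensor product `Λ*V ⊗ Λ*V`, with product `(a ⊗ b)(c ⊗ d) = (-1)^(|b||c|) ac ⊗ bd`, that maps
`x ∈ V` to `x ⊗ 1 + 1 ⊗ x`. On `x₁ ∧ ⋯ ∧ xₙ` it is the sum over all unshuffles `σ` of
`± (x_{σ(1)} ∧ ⋯ ∧ x_{σ(p)}) ⊗ (x_{σ(p+1)} ∧ ⋯ ∧ x_{σ(n)})` with the Koszul sign. -/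
def comul : GradedSym V →ₗ[k] GradedSym V ⊗[k] GradedSym V :=
  LinearMap.applyₗ (1 ⊗ₜ 1) ∘ₗ (comulAction V).toLinearMap

variable {V} in
theorem comul_ι_mul (x : M) (a : GradedSym V) :
    comul V (ι V x * a) = primMul V x (comul V a) := by
  simp [comul, comulAction]

/-- The coderivation `D̄ = m ∘ (D ⊗ 1) ∘ Δ` of `Λ*V` that belongs to `D : Λ*V → V`. -/
def coder (D : GradedSym V →ₗ[k] M) : GradedSym V →ₗ[k] GradedSym V :=
  LinearMap.mul' k (GradedSym V) ∘ₗ TensorProduct.map (ι V ∘ₗ D) LinearMap.id ∘ₗ comul V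

end GradedSym

/-- The desuspension `↓V`, with `(↓V)_n = V_{n+1}`. -/
def desusp (V : ℤ → Submodule k M) : ℤ → Submodule k M := fun n => V (n + 1)

instance desuspDecomposition (V : ℤ → Submodule k M) [DirectSum.Decomposition V] :
    DirectSum.Decomposition (desusp V) :=
  DirectSum.Decomposition.ofLinearMap (desusp V)
    (DirectSum.toModule k ℤ _ (fun i => DirectSum.lof k ℤ (fun n => desusp V n) (i - 1) ∘ₗ
        Submodule.inclusion (by simp [desusp])) ∘ₗ
      (DirectSum.decomposeLinearEquiv V).toLinearMap)
    (by
      refine DirectSum.decompose_lhom_ext V fun i => ?_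
      ext x
      simp)
    (by
      ext i x : 2
      have hx : (x : M) ∈ V (i + 1) := x.2
      have key : ∀ (j : ℤ) (y : desusp V j), j = i → (y : M) = x →
          DirectSum.lof k ℤ (fun n => desusp V n) j y =
            DirectSum.lof k ℤ (fun n => desusp V n) i x := by
        rintro j y rfl h
        rw [Subtype.ext h]
      simp only [LinearMap.comp_apply, LinearEquiv.coe_coe, DirectSum.coeLinearMap_lof,
        LinearMap.id_apply]
      rw [DirectSum.decomposeLinearEquiv_apply, DirectSum.decompose_of_mem V hx,
        ← DirectSum.lof_eq_of k, DirectSum.toModule_lof]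
      exact key _ _ (by ring) rfl)

/-- `D : Λ*(↓L) → ↓L` is an sh-Lie structure on the cochain complex `(L, d)`: `d` is a
differential of degree `+1`, `D` has degree `+1` and vanishes on scalars, the restriction of `D`
to `↓L` is `d`, and `D ∘ D̄ = 0` for the coderivation `D̄` of `Λ*(↓L)` that belongs to `D`. -/
structure IsShLie (L : ℤ → Submodule k M) [DirectSum.Decomposition L] (d : M →ₗ[k] M)
    (D : GradedSym (desusp L) →ₗ[k] M) : Prop where
  d_degree : ∀ n, ∀ x ∈ L n, d x ∈ L (n + 1)
  d_comp_d : d ∘ₗ d = 0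
  degree : ∀ n, ∀ z ∈ GradedSym.degreePart (desusp L) n, D z ∈ desusp L (n + 1)
  map_one : D 1 = 0
  map_ι : ∀ x, D (GradedSym.ι (desusp L) x) = d x
  comp_coder : D ∘ₗ GradedSym.coder (desusp L) D = 0

end Graded

/-! ### The sh-Lie structure of gauge parameters and fields -/

section Theorem

variable {k A Ξ Φ : Type*} [Field k] [CommRing A] [Algebra k A]
  [AddCommGroup Ξ] [Module k Ξ]
  [AddCommGroup Φ] [Module k Φ] [Module A Φ] [IsScalarTower k A Φ]

variable (k Ξ Φ) in
/-- The graded space `L` with total space `Ξ × Φ`: `Ξ` in degree `0`, `Φ` in degree `1` and `0`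
in all other degrees. -/
def gaugeSpace (n : ℤ) : Submodule k (Ξ × Φ) :=
  if n = 0 then LinearMap.range (LinearMap.inl k Ξ Φ)
  else if n = 1 then LinearMap.range (LinearMap.inr k Ξ Φ)
  else ⊥

theorem inl_mem_gaugeSpace (ξ : Ξ) : LinearMap.inl k Ξ Φ ξ ∈ gaugeSpace k Ξ Φ 0 := by
  simp [gaugeSpace]

theorem inr_mem_gaugeSpace (φ : Φ) : LinearMap.inr k Ξ Φ φ ∈ gaugeSpace k Ξ Φ 1 := by
  simp [gaugeSpace]

instance gaugeSpaceDecomposition : DirectSum.Decomposition (gaugeSpace k Ξ Φ) :=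
  DirectSum.Decomposition.ofLinearMap (gaugeSpace k Ξ Φ)
    (LinearMap.coprod
      (DirectSum.lof k ℤ (fun n => gaugeSpace k Ξ Φ n) 0 ∘ₗ
        (LinearMap.inl k Ξ Φ).codRestrict _ inl_mem_gaugeSpace)
      (DirectSum.lof k ℤ (fun n => gaugeSpace k Ξ Φ n) 1 ∘ₗ
        (LinearMap.inr k Ξ Φ).codRestrict _ inr_mem_gaugeSpace))
    (by ext x <;> simp)
    (by
      ext i x : 2
      obtain ⟨⟨ξ, φ⟩, hx⟩ := x
      simp only [LinearMap.comp_apply, DirectSum.coeLinearMap_lof, LinearMap.id_apply,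
        LinearMap.coprod_apply]
      by_cases h0 : i = 0
      · subst h0
        obtain rfl : φ = 0 := by simpa [gaugeSpace, eq_comm] using hx
        simp only [map_zero, add_zero]
        rfl
      · by_cases h1 : i = 1
        · subst h1
          obtain rfl : ξ = 0 := by simpa [gaugeSpace, eq_comm] using hx
          simp only [map_zero, zero_add]
          rfl
        · have hx' : (ξ, φ) = (0 : Ξ × Φ) := by simpa [gaugeSpace, h0, h1] using hx
          obtain ⟨rfl, rfl⟩ := Prod.mk_eq_zero.1 hx'
          simp only [map_zero, add_zero]
          exact (map_zero (DirectSum.lof k ℤ (fun n => gaugeSpace k Ξ Φ n) i)).symm)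

/-- The differential `∂` of `L`: `∂(ξ) = δ(ξ)(1)` for `ξ ∈ Ξ`, and `∂ = 0` on `Φ`. -/
def gaugeDiff (δ : Ξ →ₗ[k] (SymmetricAlgebra A Φ →ₗ[A] Φ)) : (Ξ × Φ) →ₗ[k] (Ξ × Φ) :=
  LinearMap.inr k Ξ Φ ∘ₗ LinearMap.applyₗ 1 ∘ₗ toBase ∘ₗ δ ∘ₗ LinearMap.fst k Ξ Φ

variable (k) in
/-- `ξ₁ ∧ ⋯ ∧ ξₘ ∧ φ₁ ∧ ⋯ ∧ φₙ` in `Λ*(↓L)`. -/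
def gaugeWedge (ξs : List Ξ) (φs : List Φ) : GradedSym (desusp (gaugeSpace k Ξ Φ)) :=
  (ξs.map fun ξ => GradedSym.ι (desusp (gaugeSpace k Ξ Φ)) (ξ, 0)).prod *
    (φs.map fun φ => GradedSym.ι (desusp (gaugeSpace k Ξ Φ)) (0, φ)).prod

/-- The defining formulas of the map `D : Λ*(↓L) → ↓L`. -/
structure IsGaugeMap (δ : Ξ →ₗ[k] (SymmetricAlgebra A Φ →ₗ[A] Φ))
    (C : Ξ →ₗ[k] Ξ →ₗ[k] (SymmetricAlgebra k Φ →ₗ[k] Ξ))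
    (D : GradedSym (desusp (gaugeSpace k Ξ Φ)) →ₗ[k] (Ξ × Φ)) : Prop where
  none : ∀ φs : List Φ, D (gaugeWedge k [] φs) = 0
  single : ∀ ξ : Ξ, D (gaugeWedge k [ξ] []) = gaugeDiff δ (ξ, 0)
  one : ∀ (ξ : Ξ) (φs : List Φ), φs ≠ [] →
    D (gaugeWedge k [ξ] φs) = (0, δ ξ (φs.map (SymmetricAlgebra.ι A Φ)).prod)
  two : ∀ (ξ₁ ξ₂ : Ξ) (φs : List Φ),
    D (gaugeWedge k [ξ₁, ξ₂] φs) = (C ξ₁ ξ₂ (φs.map (SymmetricAlgebra.ι k Φ)).prod, 0)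
  many : ∀ (ξs : List Ξ) (φs : List Φ), 2 < ξs.length → D (gaugeWedge k ξs φs) = 0

end Theorem

end ShLie

end

/-! Count entries from `Ξ`. `D` is nonzero only on wedges with one or two such entries, and it turns
these into an entry from `Φ` or `Ξ` respectively. So `D̄` lowers the number of entries from `Ξ` by
one, and `D ∘ D̄` can be nonzero only on wedges with two or three of them.

With two, unshuffling gives `δ̂(C(ξ, η)) - [δ(ξ), δ(η)]`, which is zero by BBvD (`apply_coder_two`).
With three, it gives the Jacobi expression of `C`, the signed sum of the terms `C(ξ, η) ∘ δ(ζ)‾ +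
C(C(ξ, η), ζ)` (`apply_coder_three`). By BBvD, `δ̂` sends each such term to `[[δ(ξ), δ(η)], δ(ζ)]`
(`gerstenhaber_conv`). Coderivations of `Λ*Φ` are closed under commutators, so the bracket satisfies
the Jacobi identity; the cyclic sum then lies in the kernel of `δ̂`, which is zero
(`jacobi_of_injective`).

Injectivity also gives `C(ξ, ξ) = 0`, because `δ̂(C(ξ, ξ)) = [δ(ξ), δ(ξ)] = 0`. Hence the formulas
for `D` are alternating in `Ξ` and define a map on `Λ*(↓L)` through the exterior algebra of `Ξ`
tensored with `Λ*Φ`. Uniqueness holds because the wedges span.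

The computation runs over `k` with `d = toBase ∘ δ`; the passage from `A` to `k` respects
coproducts, hence brackets. -/

noncomputable section

namespace ShLie

/-! ### Convolution on a cocommutative coalgebra -/

section Convolution

variable {R X N : Type*} [CommRing R] [AddCommGroup X] [Module R X] [Coalgebra R X]
  [AddCommGroup N] [Module R N]

/-- The map `x ↦ ∑ B x' x''` on a coalgebra that belongs to a bilinear map `B`. -/
def conv : (X →ₗ[R] X →ₗ[R] N) →ₗ[R] (X →ₗ[R] N) :=
  LinearMap.lcomp R N Coalgebra.comul ∘ₗ (TensorProduct.uncurry (RingHom.id R) X X N)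

theorem conv_apply (B : X →ₗ[R] X →ₗ[R] N) (x : X) :
    conv B x = TensorProduct.lift B (Coalgebra.comul x) := rfl

theorem conv_flip [Coalgebra.IsCocomm R X] (B : X →ₗ[R] X →ₗ[R] N) :
    conv B.flip = conv B := by
  ext x
  rw [conv_apply B, ← Coalgebra.comm_comul R x, conv_apply]
  generalize Coalgebra.comul (R := R) x = t
  induction t with
  | zero => simp
  | tmul a b => simp
  | add a b ha hb => simpa using congr($ha + $hb)

theorem map_conv {N' : Type*} [AddCommGroup N'] [Module R N'] (f : N →ₗ[R] N')
    (B : X →ₗ[R] X →ₗ[R] N) (x : X) : f (conv B x) = conv (B.compr₂ f) x := by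
  rw [conv_apply, conv_apply]
  generalize Coalgebra.comul (R := R) x = t
  induction t with
  | zero => simp
  | tmul a b => simp
  | add a b ha hb => simpa using congr($ha + $hb)

/-- The map `x ↦ ∑ T x' x'' x'''` on a coalgebra that belongs to a trilinear map `T`. -/
def conv₃ (T : X →ₗ[R] X →ₗ[R] X →ₗ[R] N) : X →ₗ[R] N := conv (conv ∘ₗ T)

/-- Coassociativity: the left side splits the second factor of the coproduct, the right side the
first. -/
theorem conv₃_eq_conv_conv (T : X →ₗ[R] X →ₗ[R] X →ₗ[R] N) :
    conv₃ T = conv (conv T) := by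
  ext x
  have h := Coalgebra.coassoc_apply (R := R) x
  have h1 : ∀ t : X ⊗[R] X, TensorProduct.lift (conv T) t =
      TensorProduct.lift (TensorProduct.uncurry (RingHom.id R) X X N ∘ₗ T)
        (TensorProduct.assoc R X X X (Coalgebra.comul.rTensor X t)) := by
    intro t
    induction t with
    | zero => simp
    | tmul a b =>
      rw [TensorProduct.lift.tmul, LinearMap.rTensor_tmul, conv_apply]
      generalize Coalgebra.comul (R := R) a = u
      induction u with
      | zero => simp
      | tmul a b => simp [TensorProduct.uncurry]
      | add a b ha hb => simpa [TensorProduct.add_tmul] using congr($ha + $hb)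
    | add a b ha hb => simpa using congr($ha + $hb)
  have h2 : ∀ t : X ⊗[R] X, TensorProduct.lift (conv ∘ₗ T) t =
      TensorProduct.lift (TensorProduct.uncurry (RingHom.id R) X X N ∘ₗ T)
        (Coalgebra.comul.lTensor X t) := by
    intro t
    induction t with
    | zero => simp
    | tmul a b => rfl
    | add a b ha hb => simpa using congr($ha + $hb)
  rw [conv₃, conv_apply, conv_apply, h1, h2, h]

/-- When the first factor is the one split again, cocommutativity exchanges the first two arguments.
-/
theorem conv₃_flip [Coalgebra.IsCocomm R X] (T : X →ₗ[R] X →ₗ[R] X →ₗ[R] N) :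
    conv₃ T.flip = conv₃ T := by
  rw [conv₃_eq_conv_conv, conv₃_eq_conv_conv, conv_flip]

end Convolution

/-! ### Coderivations and the Gerstenhaber bracket -/

section Ungraded

variable {R M N : Type*} [CommRing R] [AddCommGroup M] [Module R M] [AddCommGroup N] [Module R N]

/-- The bilinear map `(x, y) ↦ f(x) ∧ y`. -/
def insertMul (f : SymmetricAlgebra R M →ₗ[R] M) :
    SymmetricAlgebra R M →ₗ[R] SymmetricAlgebra R M →ₗ[R] SymmetricAlgebra R M :=
  LinearMap.mul R (SymmetricAlgebra R M) ∘ₗ SymmetricAlgebra.ι R M ∘ₗ f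

theorem insertMul_apply (f : SymmetricAlgebra R M →ₗ[R] M) (x y : SymmetricAlgebra R M) :
    insertMul f x y = SymmetricAlgebra.ι R M (f x) * y := rfl

theorem coder_eq_conv (f : SymmetricAlgebra R M →ₗ[R] M) : coder f = conv (insertMul f) := by
  ext x
  rw [coder, conv_apply, LinearMap.comp_apply, LinearMap.comp_apply]
  generalize Coalgebra.comul (R := R) x = t
  induction t with
  | zero => simp
  | tmul a b => simp [insertMul_apply]
  | add a b ha hb => simpa using congr($ha + $hb)

/-- `Δ` is multiplicative and `ι m` is primitive, so the factor `ι m` goes to one side or the other.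
-/
theorem conv_ι_mul (B : SymmetricAlgebra R M →ₗ[R] SymmetricAlgebra R M →ₗ[R] N) (m : M)
    (x : SymmetricAlgebra R M) :
    conv B (SymmetricAlgebra.ι R M m * x) =
      conv (B ∘ₗ LinearMap.mulLeft R (SymmetricAlgebra.ι R M m)) x +
      conv (B.compl₂ (LinearMap.mulLeft R (SymmetricAlgebra.ι R M m))) x := by
  rw [conv_apply, conv_apply, conv_apply, Bialgebra.comul_mul, SymmetricAlgebra.comul_ι]
  generalize Coalgebra.comul (R := R) x = t
  induction t with
  | zero => simp
  | tmul a b => simp [add_mul]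
  | add a b ha hb =>
    rw [mul_add, map_add, map_add, map_add, ha, hb]
    abel

/-- `f̄` is a coderivation. -/
theorem conv_coder (B : SymmetricAlgebra R M →ₗ[R] SymmetricAlgebra R M →ₗ[R] N)
    (g : SymmetricAlgebra R M →ₗ[R] M) (x : SymmetricAlgebra R M) :
    conv B (coder g x) = conv (B ∘ₗ coder g) x + conv (B.compl₂ (coder g)) x := by
  -- `(a, b, c) ↦ B (g(a) ∧ b) c`
  let T₁ : SymmetricAlgebra R M →ₗ[R] SymmetricAlgebra R M →ₗ[R] SymmetricAlgebra R M →ₗ[R] N :=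
    (insertMul g).compr₂ B
  -- `(a, b, c) ↦ B a (g(b) ∧ c)`
  let T₂ : SymmetricAlgebra R M →ₗ[R] SymmetricAlgebra R M →ₗ[R] SymmetricAlgebra R M →ₗ[R] N :=
    (LinearMap.llcomp R (SymmetricAlgebra R M) (SymmetricAlgebra R M) N ∘ₗ B).compl₂ (insertMul g)
  have h₁ : conv (B ∘ₗ coder g) = conv₃ T₁ := by
    rw [conv₃_eq_conv_conv]
    congr 1
    ext a : 1
    rw [LinearMap.comp_apply, coder_eq_conv, map_conv]
  have h₂ : conv (B.compl₂ (coder g)) = conv₃ T₂ := by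
    rw [conv₃]
    congr 1
    ext a b
    rw [LinearMap.compl₂_apply, coder_eq_conv, map_conv]
    rfl
  -- After the flip, `g` acts on the first argument in both terms, and the inserted element `g(a)`
  -- is primitive; `conv_ι_mul` then matches the two sides.
  rw [h₁, h₂, ← conv₃_flip T₂, conv₃, conv₃, coder_eq_conv, map_conv, ← LinearMap.add_apply,
    ← map_add]
  congr 2
  ext a b
  simp only [LinearMap.compr₂_apply, insertMul_apply, conv_ι_mul]
  rfl

/-- The coderivations form a Lie algebra, with the Gerstenhaber bracket. -/
theorem coder_gerstenhaber (f g : SymmetricAlgebra R M →ₗ[R] M) :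
    coder (gerstenhaber f g) = coder f ∘ₗ coder g - coder g ∘ₗ coder f := by
  -- Either `f` swallows the output of `g`, or both act on disjoint entries. The second term, `f(a)
  -- ∧ g(b) ∧ c`, is symmetric in `f` and `g` after unshuffling, so it drops out of the commutator.
  have key : ∀ f g : SymmetricAlgebra R M →ₗ[R] M, coder f ∘ₗ coder g =
      conv (insertMul (f ∘ₗ coder g)) +
        conv₃ ((LinearMap.llcomp R _ _ (SymmetricAlgebra R M) ∘ₗ insertMul f).compl₂
          (insertMul g)) := by
    intro f g
    ext x
    rw [LinearMap.comp_apply, coder_eq_conv f, conv_coder, LinearMap.add_apply, conv₃]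
    congr 3
    ext a b
    rw [LinearMap.compl₂_apply, coder_eq_conv, map_conv]
    rfl
  rw [key f g, key g f, ← conv₃_flip, coder_eq_conv]
  have h₁ : insertMul (gerstenhaber f g) =
      insertMul (f ∘ₗ coder g) - insertMul (g ∘ₗ coder f) := by
    ext a b
    simp [insertMul_apply, gerstenhaber, sub_mul]
  have h₂ : ((LinearMap.llcomp R _ _ (SymmetricAlgebra R M) ∘ₗ insertMul f).compl₂
        (insertMul g)).flip =
      (LinearMap.llcomp R _ _ (SymmetricAlgebra R M) ∘ₗ insertMul g).compl₂ (insertMul f) := by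
    ext a b c
    simp [insertMul_apply, mul_left_comm]
  rw [h₁, h₂, LinearMap.map_sub conv]
  abel

/-- The Jacobi identity for the Gerstenhaber bracket. -/
theorem gerstenhaber_jacobi (f g h : SymmetricAlgebra R M →ₗ[R] M) :
    gerstenhaber (gerstenhaber f g) h + gerstenhaber (gerstenhaber g h) f +
      gerstenhaber (gerstenhaber h f) g = 0 := by
  have key : ∀ f g h : SymmetricAlgebra R M →ₗ[R] M, gerstenhaber (gerstenhaber f g) h =
      f ∘ₗ coder g ∘ₗ coder h - g ∘ₗ coder f ∘ₗ coder h -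
        (h ∘ₗ coder f ∘ₗ coder g - h ∘ₗ coder g ∘ₗ coder f) := by
    intro f g h
    rw [gerstenhaber, coder_gerstenhaber, gerstenhaber, LinearMap.sub_comp, LinearMap.comp_sub]
    rfl
  rw [key, key, key]
  abel

end Ungraded

/-! ### The Jacobi identity for `C` -/

section Gauge

variable {k Ξ Φ : Type*} [CommRing k]
  [AddCommGroup Ξ] [Module k Ξ] [AddCommGroup Φ] [Module k Φ]

/-- `[δ̂(π), δ(η)] = δ̂(π ∘ δ(η)‾ + C(π, η))`, for `d = δ`. -/
theorem gerstenhaber_conv (d : Ξ →ₗ[k] (SymmetricAlgebra k Φ →ₗ[k] Φ))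
    (C : Ξ →ₗ[k] Ξ →ₗ[k] (SymmetricAlgebra k Φ →ₗ[k] Ξ))
    (hC : ∀ ξ η, gerstenhaber (d ξ) (d η) = conv (d ∘ₗ C ξ η))
    (π : SymmetricAlgebra k Φ →ₗ[k] Ξ) (η : Ξ) :
    gerstenhaber (conv (d ∘ₗ π)) (d η) =
      conv (d ∘ₗ (π ∘ₗ coder (d η) + conv (C.flip η ∘ₗ π))) := by
  have h₁ : conv (d ∘ₗ π) ∘ₗ coder (d η) = conv ((d ∘ₗ π) ∘ₗ coder (d η)) +
      conv ((d ∘ₗ π).compl₂ (coder (d η))) :=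
    LinearMap.ext fun x => conv_coder _ _ _
  have h₂ : d η ∘ₗ coder (conv (d ∘ₗ π)) = conv₃ ((d ∘ₗ π).compr₂
      ((LinearMap.mul k (SymmetricAlgebra k Φ)).compr₂ (d η) ∘ₗ SymmetricAlgebra.ι k Φ)) := by
    rw [conv₃_eq_conv_conv]
    ext x
    rw [LinearMap.comp_apply, coder_eq_conv, map_conv]
    congr 2
    ext a : 1
    exact map_conv
      ((LinearMap.mul k (SymmetricAlgebra k Φ)).compr₂ (d η) ∘ₗ SymmetricAlgebra.ι k Φ) _ a
  have h₃ : conv (d ∘ₗ conv (C.flip η ∘ₗ π)) = conv₃ ((C.flip η ∘ₗ π).compr₂ d) := by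
    rw [conv₃_eq_conv_conv]
    congr 1
    ext a : 1
    exact map_conv d _ a
  -- The BBvD hypothesis for the pair `π(a)`, `η`, at each `a`: it absorbs both the part of `h₁`
  -- where `δ(η)‾` hits the argument of `d(π(a))` and the whole of `h₂`.
  have h₄ : conv ∘ₗ (C.flip η ∘ₗ π).compr₂ d = (d ∘ₗ π).compl₂ (coder (d η)) -
      conv ∘ₗ (d ∘ₗ π).compr₂
        ((LinearMap.mul k (SymmetricAlgebra k Φ)).compr₂ (d η) ∘ₗ SymmetricAlgebra.ι k Φ) := by
    ext a x
    have h := congr($(hC (π a) η) x)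
    rw [gerstenhaber, coder_eq_conv (d (π a)), LinearMap.sub_apply, LinearMap.comp_apply (d η),
      map_conv] at h
    exact h.symm
  rw [LinearMap.comp_add, LinearMap.map_add conv, h₃, conv₃, h₄, LinearMap.map_sub conv,
    gerstenhaber, h₁, h₂, conv₃, LinearMap.comp_assoc]
  abel

/-- The Jacobi identity for `C` and the field dependent gauge transformations. -/
theorem jacobi_of_injective (d : Ξ →ₗ[k] (SymmetricAlgebra k Φ →ₗ[k] Φ))
    (C : Ξ →ₗ[k] Ξ →ₗ[k] (SymmetricAlgebra k Φ →ₗ[k] Ξ))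
    (hC : ∀ ξ η, gerstenhaber (d ξ) (d η) = conv (d ∘ₗ C ξ η))
    (hd : ∀ π : SymmetricAlgebra k Φ →ₗ[k] Ξ, conv (d ∘ₗ π) = 0 → π = 0) (ξ η ζ : Ξ) :
    (C ξ η ∘ₗ coder (d ζ) + conv (C.flip ζ ∘ₗ C ξ η)) +
      (C η ζ ∘ₗ coder (d ξ) + conv (C.flip ξ ∘ₗ C η ζ)) +
      (C ζ ξ ∘ₗ coder (d η) + conv (C.flip η ∘ₗ C ζ ξ)) = 0 := by
  -- `δ̂` turns the three summands into the iterated brackets of `d ξ`, `d η`, `d ζ`.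
  apply hd
  rw [LinearMap.comp_add, LinearMap.comp_add, LinearMap.map_add conv, LinearMap.map_add conv,
    ← gerstenhaber_conv d C hC, ← gerstenhaber_conv d C hC, ← gerstenhaber_conv d C hC,
    ← hC, ← hC, ← hC, gerstenhaber_jacobi]

/-- A bracket of a map with itself vanishes. This gives the alternating property directly, as needed
to pass to the exterior algebra. -/
theorem self_eq_zero_of_injective (d : Ξ →ₗ[k] (SymmetricAlgebra k Φ →ₗ[k] Φ))
    (C : Ξ →ₗ[k] Ξ →ₗ[k] (SymmetricAlgebra k Φ →ₗ[k] Ξ))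
    (hC : ∀ ξ η, gerstenhaber (d ξ) (d η) = conv (d ∘ₗ C ξ η))
    (hd : ∀ π : SymmetricAlgebra k Φ →ₗ[k] Ξ, conv (d ∘ₗ π) = 0 → π = 0) (ξ : Ξ) : C ξ ξ = 0 :=
  hd _ (by rw [← hC, gerstenhaber, sub_self])

end Gauge

/-! ### From `A`-linear to `k`-linear maps -/

section ChangeBase

variable {k A Φ : Type*} [Field k] [CommRing A] [Algebra k A]
  [AddCommGroup Φ] [Module k Φ] [Module A Φ] [IsScalarTower k A Φ]

@[simp]
theorem changeBase_ι (φ : Φ) :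
    changeBase k A Φ (SymmetricAlgebra.ι k Φ φ) = SymmetricAlgebra.ι A Φ φ := by
  simp [changeBase]

theorem toBase_apply (f : SymmetricAlgebra A Φ →ₗ[A] Φ) (x : SymmetricAlgebra k Φ) :
    toBase (k := k) f x = f (changeBase k A Φ x) := rfl

/-- `φ₁ ∧ ⋯ ∧ φₙ ↦ φ₁ ∧ ⋯ ∧ φₙ` is compatible with the comultiplication. -/
theorem conv_changeBase {N : Type*} [AddCommGroup N] [Module k N] [Module A N]
    [IsScalarTower k A N] (B : SymmetricAlgebra A Φ →ₗ[A] SymmetricAlgebra A Φ →ₗ[A] N)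
    (B' : SymmetricAlgebra k Φ →ₗ[k] SymmetricAlgebra k Φ →ₗ[k] N)
    (h : ∀ x y, B' x y = B (changeBase k A Φ x) (changeBase k A Φ y))
    (x : SymmetricAlgebra k Φ) : conv B' x = conv B (changeBase k A Φ x) := by
  let F : SymmetricAlgebra k Φ ⊗[k] SymmetricAlgebra k Φ →ₐ[k]
      SymmetricAlgebra A Φ ⊗[A] SymmetricAlgebra A Φ :=
    Algebra.TensorProduct.lift
      ((Algebra.TensorProduct.includeLeft (R := A) (S := A) (A := SymmetricAlgebra A Φ)
        (B := SymmetricAlgebra A Φ)).restrictScalars k |>.comp (changeBase k A Φ))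
      ((Algebra.TensorProduct.includeRight (R := A) (A := SymmetricAlgebra A Φ)
        (B := SymmetricAlgebra A Φ)).restrictScalars k |>.comp (changeBase k A Φ))
      (fun _ _ => Commute.all _ _)
  -- Both sides are algebra homomorphisms, so it suffices to compare them on the primitive
  -- generators.
  have hF : F.comp (Bialgebra.comulAlgHom k (SymmetricAlgebra k Φ)) =
      ((Bialgebra.comulAlgHom A (SymmetricAlgebra A Φ)).restrictScalars k).comp
        (changeBase k A Φ) := by
    ext φ
    simp [F]
  have hx : Coalgebra.comul (R := A) (changeBase k A Φ x) = F (Coalgebra.comul (R := k) x) :=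
    congr($hF x).symm
  rw [conv_apply, conv_apply, hx]
  generalize Coalgebra.comul (R := k) x = t
  induction t with
  | zero => simp
  | tmul a b => simp [F, h]
  | add a b ha hb => simpa using congr($ha + $hb)

theorem changeBase_coder (g : SymmetricAlgebra A Φ →ₗ[A] Φ) (x : SymmetricAlgebra k Φ) :
    changeBase k A Φ (coder (toBase g) x) = coder g (changeBase k A Φ x) := by
  rw [coder_eq_conv, coder_eq_conv, ← AlgHom.toLinearMap_apply, map_conv]
  refine conv_changeBase _ _ (fun x y => ?_) x
  simp [insertMul_apply, toBase_apply]

/-- This moves the BBvD hypothesis to `Λ*Φ` over `k`, where `C` and `δ̂` live. -/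
theorem toBase_gerstenhaber (f g : SymmetricAlgebra A Φ →ₗ[A] Φ) :
    toBase (k := k) (gerstenhaber f g) = gerstenhaber (toBase f) (toBase g) := by
  ext x
  simp only [toBase_apply, gerstenhaber, LinearMap.sub_apply, LinearMap.comp_apply,
    changeBase_coder]

theorem hatDelta_apply {Ξ : Type*} [AddCommGroup Ξ] [Module k Ξ]
    (δ : Ξ →ₗ[k] (SymmetricAlgebra A Φ →ₗ[A] Φ)) (π : SymmetricAlgebra k Φ →ₗ[k] Ξ) :
    hatDelta δ π = conv ((toBase ∘ₗ δ) ∘ₗ π) := rfl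

theorem changeBase_prod (φs : List Φ) :
    changeBase k A Φ (φs.map (SymmetricAlgebra.ι k Φ)).prod =
      (φs.map (SymmetricAlgebra.ι A Φ)).prod := by
  rw [map_list_prod, List.map_map]
  congr 2
  ext φ
  simp

end ChangeBase

/-! ### Spanning products and Koszul signs -/

section SymSpan

variable {R M N : Type*} [CommRing R] [AddCommGroup M] [Module R M] [AddCommMonoid N] [Module R N]

theorem span_prod_ι :
    Submodule.span R (Set.range fun l : List M => (l.map (SymmetricAlgebra.ι R M)).prod) = ⊤ := by
  refine eq_top_iff.2 fun s _ => ?_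
  induction s using SymmetricAlgebra.induction with
  | algebraMap r =>
    rw [Algebra.algebraMap_eq_smul_one]
    exact Submodule.smul_mem _ _ (Submodule.subset_span ⟨[], rfl⟩)
  | ι x => exact Submodule.subset_span ⟨[x], by simp⟩
  | add a b ha hb => exact add_mem (ha trivial) (hb trivial)
  | mul a b ha hb =>
    have h := Submodule.mul_mem_mul (ha trivial) (hb trivial)
    rw [Submodule.span_mul_span] at h
    refine Submodule.span_mono ?_ h
    rintro _ ⟨_, ⟨l, rfl⟩, _, ⟨l', rfl⟩, rfl⟩
    exact ⟨l ++ l', by simp⟩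

theorem symmetricAlgebra_hom_ext {f g : SymmetricAlgebra R M →ₗ[R] N}
    (h : ∀ l : List M, f (l.map (SymmetricAlgebra.ι R M)).prod =
      g (l.map (SymmetricAlgebra.ι R M)).prod) : f = g :=
  LinearMap.ext_on_range span_prod_ι h

end SymSpan

section Koszul

variable {k : Type*} [CommRing k]

@[simp]
theorem koszul_zero_left (j : ℤ) : koszul k 0 j = 1 := by simp [koszul]

@[simp]
theorem koszul_zero_right (j : ℤ) : koszul k j 0 = 1 := by simp [koszul]

@[simp]
theorem koszul_neg_one : koszul k (-1) (-1) = -1 := by simp [koszul]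

end Koszul

/-! ### Wedge products in `Λ*(↓L)` and the number of entries from `Ξ` -/

section Wedge

variable {k Ξ Φ : Type*} [Field k]
  [AddCommGroup Ξ] [Module k Ξ] [AddCommGroup Φ] [Module k Φ]

variable (k Ξ Φ) in
/-- The graded space `↓L`: `Ξ` in degree `-1`, `Φ` in degree `0`. -/
abbrev shiftedSpace : ℤ → Submodule k (Ξ × Φ) := desusp (gaugeSpace k Ξ Φ)

variable (k Ξ Φ) in
/-- The graded symmetric algebra on `↓L`. -/
abbrev GaugeSym : Type _ := GradedSym (shiftedSpace k Ξ Φ)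

variable (k Φ) in
theorem ghost_mem (ξ : Ξ) : ((ξ, 0) : Ξ × Φ) ∈ shiftedSpace k Ξ Φ (-1) := by
  simp [shiftedSpace, desusp, gaugeSpace]

variable (k Ξ) in
theorem field_mem (φ : Φ) : ((0, φ) : Ξ × Φ) ∈ shiftedSpace k Ξ Φ 0 := by
  simp [shiftedSpace, desusp, gaugeSpace]

theorem mem_shiftedSpace {i : ℤ} {x : Ξ × Φ} (hx : x ∈ shiftedSpace k Ξ Φ i) :
    (i = -1 ∧ ∃ ξ, x = (ξ, 0)) ∨ (i = 0 ∧ ∃ φ, x = (0, φ)) ∨ x = 0 := by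
  rw [shiftedSpace, desusp, gaugeSpace] at hx
  split_ifs at hx with h0 h1
  · obtain ⟨ξ, rfl⟩ := hx
    exact Or.inl ⟨by omega, ξ, rfl⟩
  · obtain ⟨φ, rfl⟩ := hx
    exact Or.inr (Or.inl ⟨by omega, φ, rfl⟩)
  · exact Or.inr (Or.inr hx)

variable (k Φ) in
/-- The inclusion of the gauge parameters in `Λ*(↓L)`. -/
def ghost : Ξ →ₗ[k] GaugeSym k Ξ Φ := GradedSym.ι (shiftedSpace k Ξ Φ) ∘ₗ LinearMap.inl k Ξ Φ

variable (k Ξ) in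
theorem ι_field_mul_comm (φ ψ : Φ) :
    GradedSym.ι (shiftedSpace k Ξ Φ) (0, φ) * GradedSym.ι (shiftedSpace k Ξ Φ) (0, ψ) =
    GradedSym.ι (shiftedSpace k Ξ Φ) (0, ψ) * GradedSym.ι (shiftedSpace k Ξ Φ) (0, φ) := by
  rw [GradedSym.ι_mul_ι (field_mem k Ξ φ) (field_mem k Ξ ψ), koszul_zero_left, one_smul]

open scoped IsMulCommutative in
variable (k Ξ Φ) in
-- The universal property of `SymmetricAlgebra` needs a commutative target, which `Λ*(↓L)` is not.
-- Fields have degree `0` and commute, so the subalgebra they generate serves instead.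
theorem exists_fields : ∃ F : SymmetricAlgebra k Φ →ₐ[k] GaugeSym k Ξ Φ,
    ∀ φ, F (SymmetricAlgebra.ι k Φ φ) = GradedSym.ι (shiftedSpace k Ξ Φ) (0, φ) := by
  let s : Set (GaugeSym k Ξ Φ) :=
    Set.range fun φ : Φ => GradedSym.ι (shiftedSpace k Ξ Φ) (0, φ)
  let S := Algebra.adjoin k s
  have : IsMulCommutative S := Algebra.isMulCommutative_adjoin k (by
    rintro _ ⟨φ, rfl⟩ _ ⟨ψ, rfl⟩
    exact ι_field_mul_comm k Ξ φ ψ)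
  let f : Φ →ₗ[k] S :=
    (GradedSym.ι (shiftedSpace k Ξ Φ) ∘ₗ LinearMap.inr k Ξ Φ).codRestrict
      (Subalgebra.toSubmodule S)
      (fun φ => Algebra.subset_adjoin ⟨φ, rfl⟩)
  refine ⟨S.val.comp (SymmetricAlgebra.lift f), fun φ => ?_⟩
  rw [AlgHom.comp_apply, SymmetricAlgebra.lift_ι_apply]
  rfl

variable (k Ξ Φ) in
/-- The inclusion of `Λ*Φ` in `Λ*(↓L)`. -/
def fields : SymmetricAlgebra k Φ →ₐ[k] GaugeSym k Ξ Φ := (exists_fields k Ξ Φ).choose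

theorem fields_ι (φ : Φ) :
    fields k Ξ Φ (SymmetricAlgebra.ι k Φ φ) = GradedSym.ι (shiftedSpace k Ξ Φ) (0, φ) :=
  (exists_fields k Ξ Φ).choose_spec φ

theorem ι_ghost (ξ : Ξ) : GradedSym.ι (shiftedSpace k Ξ Φ) (ξ, 0) = ghost k Φ ξ := rfl

theorem ι_field_mul_ghost (φ : Φ) (ξ : Ξ) :
    GradedSym.ι (shiftedSpace k Ξ Φ) (0, φ) * ghost k Φ ξ =
      ghost k Φ ξ * GradedSym.ι (shiftedSpace k Ξ Φ) (0, φ) := by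
  rw [← ι_ghost, GradedSym.ι_mul_ι (field_mem k Ξ φ) (ghost_mem k Φ ξ), koszul_zero_left, one_smul]

theorem fields_mul_ghost (s : SymmetricAlgebra k Φ) (ξ : Ξ) :
    fields k Ξ Φ s * ghost k Φ ξ = ghost k Φ ξ * fields k Ξ Φ s := by
  change Commute _ _
  induction s using SymmetricAlgebra.induction with
  | algebraMap r =>
    rw [Algebra.algebraMap_eq_smul_one, map_smul, map_one]
    exact (Commute.one_left _).smul_left r
  | ι φ => rw [fields_ι]; exact ι_field_mul_ghost φ ξ
  | mul a b ha hb => rw [map_mul]; exact ha.mul_left hb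
  | add a b ha hb => rw [map_add]; exact ha.add_left hb

theorem fields_mul_ghost_mul (s : SymmetricAlgebra k Φ) (ξ : Ξ) (z : GaugeSym k Ξ Φ) :
    fields k Ξ Φ s * (ghost k Φ ξ * z) = ghost k Φ ξ * (fields k Ξ Φ s * z) := by
  rw [← mul_assoc, fields_mul_ghost, mul_assoc]

/-- `ξ₁ ∧ ⋯ ∧ ξₘ ∧ s` for `s ∈ Λ*Φ`. -/
def wedge (ξs : List Ξ) (s : SymmetricAlgebra k Φ) : GaugeSym k Ξ Φ :=
  (ξs.map (ghost k Φ)).prod * fields k Ξ Φ s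

theorem wedge_nil (s : SymmetricAlgebra k Φ) : wedge ([] : List Ξ) s = fields k Ξ Φ s := by
  simp [wedge]

theorem wedge_cons (ξ : Ξ) (ξs : List Ξ) (s : SymmetricAlgebra k Φ) :
    wedge (ξ :: ξs) s = ghost k Φ ξ * wedge ξs s := by
  simp [wedge, mul_assoc]

theorem fields_mul_wedge (a : SymmetricAlgebra k Φ) (ξs : List Ξ) (s : SymmetricAlgebra k Φ) :
    fields k Ξ Φ a * wedge ξs s = wedge ξs (a * s) := by
  induction ξs with
  | nil => rw [wedge_nil, wedge_nil, map_mul]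
  | cons ξ ξs ih => rw [wedge_cons, wedge_cons, fields_mul_ghost_mul, ih]

theorem gaugeWedge_eq_wedge (ξs : List Ξ) (φs : List Φ) :
    gaugeWedge k ξs φs = wedge ξs (φs.map (SymmetricAlgebra.ι k Φ)).prod := by
  rw [gaugeWedge, wedge, map_list_prod, List.map_map]
  congr 3
  ext φ
  exact (fields_ι φ).symm

variable (k Ξ Φ) in
/-- The part of `Λ*(↓L)` that is spanned by wedge products with `m` entries from `Ξ`. -/
def ghostPart (m : ℕ) : Submodule k (GaugeSym k Ξ Φ) :=
  Submodule.span k {z | ∃ (ξs : List Ξ) (s : SymmetricAlgebra k Φ), ξs.length = m ∧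
    z = wedge ξs s}

theorem wedge_mem_ghostPart (ξs : List Ξ) (s : SymmetricAlgebra k Φ) :
    wedge ξs s ∈ ghostPart k Ξ Φ ξs.length :=
  Submodule.subset_span ⟨ξs, s, rfl, rfl⟩

theorem map_mem_of_mem_ghostPart {N : Type*} [AddCommGroup N] [Module k N]
    (f : GaugeSym k Ξ Φ →ₗ[k] N) {P : Submodule k N} {m : ℕ}
    (h : ∀ (ξs : List Ξ) (s : SymmetricAlgebra k Φ), ξs.length = m → f (wedge ξs s) ∈ P)
    {z : GaugeSym k Ξ Φ} (hz : z ∈ ghostPart k Ξ Φ m) : f z ∈ P := by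
  have : ghostPart k Ξ Φ m ≤ P.comap f := by
    refine Submodule.span_le.2 ?_
    rintro _ ⟨ξs, s, hm, rfl⟩
    exact h ξs s hm
  exact this hz

theorem ghost_mul_mem (ξ : Ξ) {m : ℕ} {z : GaugeSym k Ξ Φ} (hz : z ∈ ghostPart k Ξ Φ m) :
    ghost k Φ ξ * z ∈ ghostPart k Ξ Φ (m + 1) := by
  refine map_mem_of_mem_ghostPart (LinearMap.mulLeft k (ghost k Φ ξ)) ?_ hz
  rintro ξs s rfl
  exact Submodule.subset_span ⟨ξ :: ξs, s, rfl, (wedge_cons _ _ _).symm⟩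

theorem fields_mul_mem (a : SymmetricAlgebra k Φ) {m : ℕ} {z : GaugeSym k Ξ Φ}
    (hz : z ∈ ghostPart k Ξ Φ m) : fields k Ξ Φ a * z ∈ ghostPart k Ξ Φ m := by
  refine map_mem_of_mem_ghostPart (LinearMap.mulLeft k (fields k Ξ Φ a)) ?_ hz
  rintro ξs s rfl
  exact Submodule.subset_span ⟨ξs, a * s, rfl, fields_mul_wedge _ _ _⟩

variable (k Ξ Φ) in
-- The span contains `1` and is stable under left multiplication by generators: an entry from `Ξ` is
-- prepended, and a field moves past the entries from `Ξ` without sign.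
theorem span_wedge : Submodule.span k {z : GaugeSym k Ξ Φ | ∃ ξs s, z = wedge ξs s} = ⊤ := by
  set S := Submodule.span k {z : GaugeSym k Ξ Φ | ∃ ξs s, z = wedge ξs s} with hS
  have key : ∀ y z : GaugeSym k Ξ Φ, (∀ ξs s, y * wedge ξs s ∈ S) → z ∈ S → y * z ∈ S := by
    intro y z hy hz
    have : S ≤ S.comap (LinearMap.mulLeft k y) := by
      refine Submodule.span_le.2 ?_
      rintro _ ⟨ξs, s, rfl⟩
      exact hy ξs s
    exact this hz
  have hmul : ∀ (a : TensorAlgebra k (Ξ × Φ)) (z : GaugeSym k Ξ Φ), z ∈ S →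
      RingQuot.mkAlgHom k (GradedSymRel (shiftedSpace k Ξ Φ)) a * z ∈ S := by
    intro a
    induction a using TensorAlgebra.induction with
    | algebraMap r =>
      intro z hz
      rw [AlgHom.commutes, ← Algebra.smul_def]
      exact S.smul_mem _ hz
    | ι x =>
      intro z hz
      obtain ⟨ξ, φ⟩ := x
      change GradedSym.ι (shiftedSpace k Ξ Φ) (ξ, φ) * z ∈ S
      have hx : GradedSym.ι (shiftedSpace k Ξ Φ) (ξ, φ) =
          ghost k Φ ξ + fields k Ξ Φ (SymmetricAlgebra.ι k Φ φ) := by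
        rw [fields_ι, ← ι_ghost, ← map_add]
        simp
      rw [hx, add_mul]
      refine add_mem (key _ _ (fun ξs s => ?_) hz) (key _ _ (fun ξs s => ?_) hz)
      · exact Submodule.subset_span ⟨_, _, (wedge_cons _ _ _).symm⟩
      · exact Submodule.subset_span ⟨_, _, fields_mul_wedge _ _ _⟩
    | mul a b ha hb =>
      intro z hz
      rw [map_mul, mul_assoc]
      exact ha _ (hb _ hz)
    | add a b ha hb =>
      intro z hz
      rw [map_add, add_mul]
      exact add_mem (ha _ hz) (hb _ hz)
  refine eq_top_iff.2 fun z _ => ?_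
  obtain ⟨a, rfl⟩ := RingQuot.mkAlgHom_surjective k (GradedSymRel (shiftedSpace k Ξ Φ)) z
  have h1 : (1 : GaugeSym k Ξ Φ) ∈ S := Submodule.subset_span ⟨[], 1, by simp [wedge_nil]⟩
  simpa using hmul a 1 h1

theorem gaugeSym_hom_ext {N : Type*} [AddCommGroup N] [Module k N]
    {f g : GaugeSym k Ξ Φ →ₗ[k] N} (h : ∀ ξs s, f (wedge ξs s) = g (wedge ξs s)) : f = g := by
  refine LinearMap.ext_on (span_wedge k Ξ Φ) ?_
  rintro _ ⟨ξs, s, rfl⟩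
  exact h ξs s

/-- An element of degree `n` has `-n` entries from `Ξ`. -/
theorem mem_ghostPart_of_degreePart {P : GaugeSym k Ξ Φ → Prop}
    (h0 : P 0) (hadd : ∀ a b, P a → P b → P (a + b)) (hsmul : ∀ (c : k) a, P a → P (c • a))
    {n : ℤ} (h : ∀ m : ℕ, n = -m → ∀ z ∈ ghostPart k Ξ Φ m, P z)
    {z : GaugeSym k Ξ Φ} (hz : z ∈ GradedSym.degreePart (shiftedSpace k Ξ Φ) n) : P z := by
  -- The entry `0` is homogeneous of every degree, so the degrees may fail to count entries from
  -- `Ξ`; the product is then `0`.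
  have key : ∀ l : List (ℤ × (Ξ × Φ)), (∀ p ∈ l, p.2 ∈ shiftedSpace k Ξ Φ p.1) →
      (l.map fun p => GradedSym.ι (shiftedSpace k Ξ Φ) p.2).prod = 0 ∨
      ∃ m : ℕ, (l.map Prod.fst).sum = -m ∧
        (l.map fun p => GradedSym.ι (shiftedSpace k Ξ Φ) p.2).prod ∈ ghostPart k Ξ Φ m := by
    intro l hl
    induction l with
    | nil =>
      have h1 := wedge_mem_ghostPart ([] : List Ξ) (1 : SymmetricAlgebra k Φ)
      rw [wedge_nil, map_one] at h1
      exact Or.inr ⟨0, by simp, h1⟩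
    | cons p l ih =>
      obtain ⟨i, x⟩ := p
      rw [List.forall_mem_cons] at hl
      simp only [List.map_cons, List.prod_cons, List.sum_cons]
      rcases ih hl.2 with h | ⟨m, hm, h⟩
      · exact Or.inl (by rw [h, mul_zero])
      · rcases mem_shiftedSpace hl.1 with ⟨hi, ξ, hx⟩ | ⟨hi, φ, hx⟩ | hx
        · refine Or.inr ⟨m + 1, by rw [hm]; push_cast; simp only at hi; omega, ?_⟩
          simp only at hx
          rw [hx, ι_ghost]
          exact ghost_mul_mem ξ h
        · refine Or.inr ⟨m, by rw [hm]; simp only at hi; omega, ?_⟩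
          simp only at hx
          rw [hx, ← fields_ι]
          exact fields_mul_mem _ h
        · simp only at hx
          exact Or.inl (by rw [hx, map_zero, zero_mul])
  refine Submodule.span_induction ?_ h0 (fun a b _ _ => hadd a b) (fun c a _ => hsmul c a) hz
  rintro _ ⟨l, hl, hn, rfl⟩
  rcases key l hl with h' | ⟨m, hm, h'⟩
  · rw [h']
    exact h0
  · exact h m (hn.symm.trans hm) _ h'

end Wedge

/-! ### The comultiplication on wedge products -/

section Comultiplication

variable {k Ξ Φ : Type*} [Field k]
  [AddCommGroup Ξ] [Module k Ξ] [AddCommGroup Φ] [Module k Φ]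

theorem signHom_ghost (i : ℤ) (ξ : Ξ) :
    GradedSym.signHom (shiftedSpace k Ξ Φ) i (ghost k Φ ξ) = koszul k i (-1) • ghost k Φ ξ :=
  GradedSym.signHom_ι i (ghost_mem k Φ ξ)

theorem signHom_fields (i : ℤ) (s : SymmetricAlgebra k Φ) :
    GradedSym.signHom (shiftedSpace k Ξ Φ) i (fields k Ξ Φ s) = fields k Ξ Φ s := by
  induction s using SymmetricAlgebra.induction with
  | algebraMap r => rw [AlgHom.commutes, AlgHom.commutes]
  | ι φ => rw [fields_ι, GradedSym.signHom_ι i (field_mem k Ξ φ), koszul_zero_right, one_smul]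
  | mul a b ha hb => rw [map_mul, map_mul, ha, hb]
  | add a b ha hb => rw [map_add, map_add, ha, hb]

theorem signHom_mem (i : ℤ) {m : ℕ} {z : GaugeSym k Ξ Φ} (hz : z ∈ ghostPart k Ξ Φ m) :
    GradedSym.signHom (shiftedSpace k Ξ Φ) i z ∈ ghostPart k Ξ Φ m := by
  refine map_mem_of_mem_ghostPart
    (GradedSym.signHom (shiftedSpace k Ξ Φ) i).toLinearMap ?_ hz
  rintro ξs s rfl
  clear hz
  rw [AlgHom.toLinearMap_apply]
  induction ξs with
  | nil =>
    rw [wedge_nil, signHom_fields, ← wedge_nil]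
    exact wedge_mem_ghostPart _ _
  | cons ξ ξs ih =>
    rw [wedge_cons, map_mul, signHom_ghost, smul_mul_assoc]
    exact Submodule.smul_mem _ _ (ghost_mul_mem ξ ih)

theorem comul_one : GradedSym.comul (shiftedSpace k Ξ Φ) 1 = 1 ⊗ₜ[k] 1 := by
  simp [GradedSym.comul]

/-- No Koszul signs arise in degree `0`, so on `Λ*Φ` the graded coproduct is the ordinary one. -/
theorem comul_fields (s : SymmetricAlgebra k Φ) :
    GradedSym.comul (shiftedSpace k Ξ Φ) (fields k Ξ Φ s) =
      TensorProduct.map (fields k Ξ Φ).toLinearMap (fields k Ξ Φ).toLinearMap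
        (Coalgebra.comul s) := by
  have h : GradedSym.comul (shiftedSpace k Ξ Φ) ∘ₗ (fields k Ξ Φ).toLinearMap =
      TensorProduct.map (fields k Ξ Φ).toLinearMap (fields k Ξ Φ).toLinearMap ∘ₗ
        Coalgebra.comul (R := k) (A := SymmetricAlgebra k Φ) := by
    refine symmetricAlgebra_hom_ext fun l => ?_
    induction l with
    | nil => simp [comul_one, Algebra.TensorProduct.one_def]
    | cons φ l ih =>
      simp only [LinearMap.comp_apply, AlgHom.toLinearMap_apply, List.map_cons, List.prod_cons,
        map_mul, fields_ι, GradedSym.comul_ι_mul, Bialgebra.comul_mul,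
        SymmetricAlgebra.comul_ι] at ih ⊢
      rw [ih]
      generalize Coalgebra.comul (R := k) (l.map (SymmetricAlgebra.ι k Φ)).prod = t
      induction t with
      | zero => simp
      | tmul a b =>
        simp [GradedSym.primMul_tmul (field_mem k Ξ φ), add_mul, signHom_fields, fields_ι]
      | add a b ha hb => simp only [map_add, mul_add, ha, hb]
  exact congr($h s)

theorem comul_wedge_cons (ξ : Ξ) (ξs : List Ξ) (s : SymmetricAlgebra k Φ) :
    GradedSym.comul (shiftedSpace k Ξ Φ) (wedge (ξ :: ξs) s) =
      GradedSym.primMul (shiftedSpace k Ξ Φ) (ξ, 0)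
        (GradedSym.comul (shiftedSpace k Ξ Φ) (wedge ξs s)) := by
  rw [wedge_cons, ← ι_ghost, GradedSym.comul_ι_mul]

theorem primMul_ghost_tmul (ξ : Ξ) (a b : GaugeSym k Ξ Φ) :
    GradedSym.primMul (shiftedSpace k Ξ Φ) (ξ, 0) (a ⊗ₜ b) = (ghost k Φ ξ * a) ⊗ₜ b +
      GradedSym.signHom (shiftedSpace k Ξ Φ) (-1) a ⊗ₜ (ghost k Φ ξ * b) :=
  GradedSym.primMul_tmul (ghost_mem k Φ ξ) a b

variable (k Ξ Φ) in
/-- The part of `Λ*(↓L) ⊗ Λ*(↓L)` with `m` entries from `Ξ`. -/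
def tensorPart (m : ℕ) : Submodule k (GaugeSym k Ξ Φ ⊗[k] GaugeSym k Ξ Φ) :=
  Submodule.span k {t | ∃ i j : ℕ, i + j = m ∧ ∃ a ∈ ghostPart k Ξ Φ i,
    ∃ b ∈ ghostPart k Ξ Φ j, t = a ⊗ₜ b}

theorem primMul_ghost_mem (ξ : Ξ) {m : ℕ} {t : GaugeSym k Ξ Φ ⊗[k] GaugeSym k Ξ Φ}
    (ht : t ∈ tensorPart k Ξ Φ m) :
    GradedSym.primMul (shiftedSpace k Ξ Φ) (ξ, 0) t ∈ tensorPart k Ξ Φ (m + 1) := by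
  unfold tensorPart at ht
  induction ht using Submodule.span_induction with
  | zero => rw [map_zero]; exact zero_mem _
  | add x y _ _ hx hy => rw [map_add]; exact add_mem hx hy
  | smul c x _ hx => rw [map_smul]; exact Submodule.smul_mem _ _ hx
  | mem x hx =>
    obtain ⟨i, j, hm, a, ha, b, hb, rfl⟩ := hx
    rw [primMul_ghost_tmul]
    exact add_mem
      (Submodule.subset_span ⟨i + 1, j, by omega, _, ghost_mul_mem ξ ha, _, hb, rfl⟩)
      (Submodule.subset_span ⟨i, j + 1, by omega, _, signHom_mem _ ha, _,
        ghost_mul_mem ξ hb, rfl⟩)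

theorem map_fields_mem (t : SymmetricAlgebra k Φ ⊗[k] SymmetricAlgebra k Φ) :
    TensorProduct.map (fields k Ξ Φ).toLinearMap (fields k Ξ Φ).toLinearMap t ∈
      tensorPart k Ξ Φ 0 := by
  induction t with
  | zero => rw [map_zero]; exact zero_mem _
  | tmul a b =>
    rw [TensorProduct.map_tmul, AlgHom.toLinearMap_apply, AlgHom.toLinearMap_apply,
      ← wedge_nil, ← wedge_nil]
    exact Submodule.subset_span ⟨0, 0, rfl, _, wedge_mem_ghostPart [] a, _,
      wedge_mem_ghostPart [] b, rfl⟩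
  | add a b ha hb =>
    rw [map_add]
    exact add_mem ha hb

theorem comul_wedge_mem (ξs : List Ξ) (s : SymmetricAlgebra k Φ) :
    GradedSym.comul (shiftedSpace k Ξ Φ) (wedge ξs s) ∈ tensorPart k Ξ Φ ξs.length := by
  induction ξs with
  | nil =>
    rw [wedge_nil, comul_fields]
    exact map_fields_mem _
  | cons ξ ξs ih =>
    rw [comul_wedge_cons]
    exact primMul_ghost_mem ξ ih

end Comultiplication

/-! ### Construction of `D` -/

section Existence

variable {k Ξ Φ : Type*} [Field k]
  [AddCommGroup Ξ] [Module k Ξ] [AddCommGroup Φ] [Module k Φ]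

/-- The alternating map that belongs to an alternating bilinear map. -/
def alternatingOfBilinear {N : Type*} [AddCommGroup N] [Module k N] (B : Ξ →ₗ[k] Ξ →ₗ[k] N)
    (hB : ∀ ξ, B ξ ξ = 0) : Ξ [⋀^Fin 2]→ₗ[k] N where
  toFun v := B (v 0) (v 1)
  map_update_add' := by
    intro inst v i x y
    rw [Subsingleton.elim inst (instDecidableEqFin 2)]
    fin_cases i <;> simp
  map_update_smul' := by
    intro inst v i c x
    rw [Subsingleton.elim inst (instDecidableEqFin 2)]
    fin_cases i <;> simp
  map_eq_zero_of_eq' v i j h hij := by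
    fin_cases i <;> fin_cases j <;> simp_all

variable (k Ξ Φ) in
/-- The map from `Λ*(↓L)` to the product of the exterior algebra of `Ξ` and `Λ*Φ`. -/
def toExteriorTensor :
    GaugeSym k Ξ Φ →ₐ[k] ExteriorAlgebra k Ξ ⊗[k] SymmetricAlgebra k Φ :=
  GradedSym.lift
    (LinearMap.coprod
      ((TensorProduct.mk k (ExteriorAlgebra k Ξ) (SymmetricAlgebra k Φ)).flip 1 ∘ₗ
        ExteriorAlgebra.ι k)
      (TensorProduct.mk k (ExteriorAlgebra k Ξ) (SymmetricAlgebra k Φ) 1 ∘ₗ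
        SymmetricAlgebra.ι k Φ)) (by
    intro i j x y hx hy
    rcases mem_shiftedSpace hx with ⟨rfl, ξ, rfl⟩ | ⟨rfl, φ, rfl⟩ | rfl
    · rcases mem_shiftedSpace hy with ⟨rfl, η, rfl⟩ | ⟨rfl, ψ, rfl⟩ | rfl
      -- Two entries of degree `-1` are the only case with a sign, and it is the exterior relation.
      · have h := ExteriorAlgebra.ι_add_mul_swap (R := k) ξ η
        rw [koszul_neg_one]
        simp only [LinearMap.coprod_apply, LinearMap.comp_apply, LinearMap.flip_apply,
          TensorProduct.mk_apply, map_zero, add_zero,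
          Algebra.TensorProduct.tmul_mul_tmul, mul_one]
        rw [TensorProduct.smul_tmul', neg_one_smul, eq_neg_of_add_eq_zero_left h]
      · simp
      · simp
    · rcases mem_shiftedSpace hy with ⟨rfl, η, rfl⟩ | ⟨rfl, ψ, rfl⟩ | rfl
      · simp
      · simp [mul_comm]
      · simp
    · simp)

theorem toExteriorTensor_wedge (ξs : List Ξ) (s : SymmetricAlgebra k Φ) :
    toExteriorTensor k Ξ Φ (wedge ξs s) = (ξs.map (ExteriorAlgebra.ι k)).prod ⊗ₜ s := by
  induction ξs with
  | nil =>
    rw [wedge_nil]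
    have h : (toExteriorTensor k Ξ Φ).comp (fields k Ξ Φ) =
        Algebra.TensorProduct.includeRight := by
      refine AlgHom.toLinearMap_injective (symmetricAlgebra_hom_ext fun l => ?_)
      rw [AlgHom.toLinearMap_apply, AlgHom.toLinearMap_apply, map_list_prod, map_list_prod,
        List.map_map, List.map_map]
      congr 2
      ext φ
      simp [fields_ι, toExteriorTensor]
    exact congr($h s)
  | cons ξ ξs ih =>
    rw [wedge_cons, map_mul, ih, ← ι_ghost, toExteriorTensor, GradedSym.lift_ι]
    simp

/-- The components of `D` on the exterior powers of `Ξ`. -/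
def gaugeComponents (d : Ξ →ₗ[k] (SymmetricAlgebra k Φ →ₗ[k] Φ))
    (C : Ξ →ₗ[k] Ξ →ₗ[k] (SymmetricAlgebra k Φ →ₗ[k] Ξ)) (hC : ∀ ξ, C ξ ξ = 0) :
    ∀ n : ℕ, Ξ [⋀^Fin n]→ₗ[k] (SymmetricAlgebra k Φ →ₗ[k] (Ξ × Φ))
  | 0 => 0
  | 1 => AlternatingMap.ofSubsingleton k Ξ _ 0 (d.compr₂ (LinearMap.inr k Ξ Φ))
  | 2 => alternatingOfBilinear (C.compr₂ (LinearMap.compRight k (LinearMap.inl k Ξ Φ)))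
      (fun ξ => by simp [hC])
  | _ + 3 => 0

/-- The formulas for `D` on `ξ₁ ∧ ⋯ ∧ ξₘ ∧ s` with `s ∈ Λ*Φ`, for `d = δ`. -/
structure HasComponents (d : Ξ →ₗ[k] (SymmetricAlgebra k Φ →ₗ[k] Φ))
    (C : Ξ →ₗ[k] Ξ →ₗ[k] (SymmetricAlgebra k Φ →ₗ[k] Ξ))
    (D : GaugeSym k Ξ Φ →ₗ[k] (Ξ × Φ)) : Prop where
  none : ∀ s, D (wedge [] s) = 0
  one : ∀ ξ s, D (wedge [ξ] s) = (0, d ξ s)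
  two : ∀ ξ η s, D (wedge [ξ, η] s) = (C ξ η s, 0)
  many : ∀ ξs s, 2 < ξs.length → D (wedge ξs s) = 0

/-- A linear map on the exterior algebra is a family of alternating maps, one for each degree, so
the components can be prescribed independently. -/
theorem exists_hasComponents (d : Ξ →ₗ[k] (SymmetricAlgebra k Φ →ₗ[k] Φ))
    (C : Ξ →ₗ[k] Ξ →ₗ[k] (SymmetricAlgebra k Φ →ₗ[k] Ξ)) (hC : ∀ ξ, C ξ ξ = 0) :
    ∃ D : GaugeSym k Ξ Φ →ₗ[k] (Ξ × Φ), HasComponents d C D := by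
  have h : ∀ (ξs : List Ξ) (s : SymmetricAlgebra k Φ), (TensorProduct.lift
      (ExteriorAlgebra.liftAlternating (gaugeComponents d C hC)) ∘ₗ
        (toExteriorTensor k Ξ Φ).toLinearMap) (wedge ξs s) =
      gaugeComponents d C hC ξs.length ξs.get s := by
    intro ξs s
    rw [LinearMap.comp_apply, AlgHom.toLinearMap_apply, toExteriorTensor_wedge,
      TensorProduct.lift.tmul, ← ExteriorAlgebra.liftAlternating_apply_ιMulti,
      ExteriorAlgebra.ιMulti_apply]
    congr 3
    conv_lhs => rw [← List.ofFn_get ξs, List.map_ofFn]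
    rfl
  refine ⟨TensorProduct.lift (ExteriorAlgebra.liftAlternating (gaugeComponents d C hC)) ∘ₗ
    (toExteriorTensor k Ξ Φ).toLinearMap, fun s => ?_, fun ξ s => ?_, fun ξ η s => ?_,
    fun ξs s hξs => ?_⟩
  · rw [h]
    rfl
  · rw [h]
    rfl
  · rw [h]
    rfl
  · obtain ⟨n, hn⟩ : ∃ n, ξs.length = n + 3 := ⟨ξs.length - 3, by omega⟩
    rw [h]
    -- The type of `ξs.get` depends on the length, so it is generalized before the length is
    -- rewritten to `n + 3`, where the component is `0` by definition.
    generalize ξs.get = v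
    revert v
    rw [hn]
    intro v
    rfl

end Existence

/-! ### Degrees of `D` and `D̄` -/

section Coderivation

variable {k Ξ Φ : Type*} [Field k]
  [AddCommGroup Ξ] [Module k Ξ] [AddCommGroup Φ] [Module k Φ]

namespace HasComponents

variable {d : Ξ →ₗ[k] (SymmetricAlgebra k Φ →ₗ[k] Φ)}
  {C : Ξ →ₗ[k] Ξ →ₗ[k] (SymmetricAlgebra k Φ →ₗ[k] Ξ)} {D : GaugeSym k Ξ Φ →ₗ[k] (Ξ × Φ)}

theorem unique (hD : HasComponents d C D) {D' : GaugeSym k Ξ Φ →ₗ[k] (Ξ × Φ)}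
    (hD' : HasComponents d C D') : D' = D := by
  refine gaugeSym_hom_ext fun ξs s => ?_
  match ξs with
  | [] => rw [hD.none, hD'.none]
  | [ξ] => rw [hD.one, hD'.one]
  | [ξ, η] => rw [hD.two, hD'.two]
  | ξ :: η :: ζ :: ξs => rw [hD.many _ _ (by simp), hD'.many _ _ (by simp)]

theorem apply_ghostPart_zero (hD : HasComponents d C D) {z : GaugeSym k Ξ Φ}
    (hz : z ∈ ghostPart k Ξ Φ 0) : D z = 0 := by
  refine map_mem_of_mem_ghostPart D (P := ⊥) (fun ξs s hm => ?_) hz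
  rw [List.length_eq_zero_iff.1 hm]
  exact hD.none s

theorem apply_ghostPart_one (hD : HasComponents d C D) {z : GaugeSym k Ξ Φ}
    (hz : z ∈ ghostPart k Ξ Φ 1) : ∃ φ, D z = (0, φ) := by
  have h : D z ∈ LinearMap.range (LinearMap.inr k Ξ Φ) := by
    refine map_mem_of_mem_ghostPart D (fun ξs s hm => ?_) hz
    obtain ⟨ξ, rfl⟩ := List.length_eq_one_iff.1 hm
    exact ⟨_, (hD.one ξ s).symm⟩
  obtain ⟨φ, h⟩ := h
  exact ⟨φ, h.symm⟩

theorem apply_ghostPart_two (hD : HasComponents d C D) {z : GaugeSym k Ξ Φ}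
    (hz : z ∈ ghostPart k Ξ Φ 2) : ∃ ξ, D z = (ξ, 0) := by
  have h : D z ∈ LinearMap.range (LinearMap.inl k Ξ Φ) := by
    refine map_mem_of_mem_ghostPart D (fun ξs s hm => ?_) hz
    obtain ⟨ξ, η, rfl⟩ := List.length_eq_two.1 hm
    exact ⟨_, (hD.two ξ η s).symm⟩
  obtain ⟨ξ, h⟩ := h
  exact ⟨ξ, h.symm⟩

theorem apply_ghostPart_of_two_lt (hD : HasComponents d C D) {m : ℕ} (hm : 2 < m)
    {z : GaugeSym k Ξ Φ} (hz : z ∈ ghostPart k Ξ Φ m) : D z = 0 := by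
  refine map_mem_of_mem_ghostPart D (P := ⊥) (fun ξs s h => ?_) hz
  exact hD.many ξs s (h ▸ hm)

theorem apply_degreePart (hD : HasComponents d C D) {n : ℤ} {z : GaugeSym k Ξ Φ}
    (hz : z ∈ GradedSym.degreePart (shiftedSpace k Ξ Φ) n) :
    D z ∈ shiftedSpace k Ξ Φ (n + 1) := by
  refine mem_ghostPart_of_degreePart (P := fun z => D z ∈ shiftedSpace k Ξ Φ (n + 1))
    ?_ ?_ ?_ ?_ hz
  · rw [map_zero]
    exact zero_mem _
  · intro a b ha hb
    rw [map_add]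
    exact add_mem ha hb
  · intro c a ha
    rw [map_smul]
    exact Submodule.smul_mem _ _ ha
  · rintro m rfl z hz
    match m with
    | 0 =>
      rw [hD.apply_ghostPart_zero hz]
      exact zero_mem _
    | 1 =>
      obtain ⟨φ, h⟩ := hD.apply_ghostPart_one hz
      rw [h]
      exact field_mem k Ξ φ
    | 2 =>
      obtain ⟨ξ, h⟩ := hD.apply_ghostPart_two hz
      rw [h]
      exact ghost_mem k Φ ξ
    | m + 3 =>
      rw [hD.apply_ghostPart_of_two_lt (by omega) hz]
      exact zero_mem _

/-- The map `m ∘ (D ⊗ 1)`. -/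
def contract (D : GaugeSym k Ξ Φ →ₗ[k] (Ξ × Φ)) :
    GaugeSym k Ξ Φ ⊗[k] GaugeSym k Ξ Φ →ₗ[k] GaugeSym k Ξ Φ :=
  LinearMap.mul' k (GaugeSym k Ξ Φ) ∘ₗ
    TensorProduct.map (GradedSym.ι (shiftedSpace k Ξ Φ) ∘ₗ D) LinearMap.id

theorem contract_tmul (D : GaugeSym k Ξ Φ →ₗ[k] (Ξ × Φ)) (a b : GaugeSym k Ξ Φ) :
    contract D (a ⊗ₜ b) = GradedSym.ι (shiftedSpace k Ξ Φ) (D a) * b := rfl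

theorem coder_apply (D : GaugeSym k Ξ Φ →ₗ[k] (Ξ × Φ)) (z : GaugeSym k Ξ Φ) :
    GradedSym.coder (shiftedSpace k Ξ Φ) D z =
      contract D (GradedSym.comul (shiftedSpace k Ξ Φ) z) := rfl

/-- `D` trades one entry from `Ξ` for a field, or two for one, and kills everything else; each
surviving term loses exactly one. For `m = 0` the truncated `m - 1` does no harm, since every term
vanishes. -/
theorem contract_mem (hD : HasComponents d C D) {m : ℕ}
    {t : GaugeSym k Ξ Φ ⊗[k] GaugeSym k Ξ Φ} (ht : t ∈ tensorPart k Ξ Φ m) :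
    contract D t ∈ ghostPart k Ξ Φ (m - 1) := by
  unfold tensorPart at ht
  induction ht using Submodule.span_induction with
  | zero => rw [map_zero]; exact zero_mem _
  | add x y _ _ hx hy => rw [map_add]; exact add_mem hx hy
  | smul c x _ hx => rw [map_smul]; exact Submodule.smul_mem _ _ hx
  | mem x hx =>
    obtain ⟨i, j, rfl, a, ha, b, hb, rfl⟩ := hx
    rw [contract_tmul]
    match i with
    | 0 =>
      rw [hD.apply_ghostPart_zero ha, map_zero, zero_mul]
      exact zero_mem _
    | 1 =>
      obtain ⟨φ, h⟩ := hD.apply_ghostPart_one ha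
      rw [h, ← fields_ι, Nat.add_sub_cancel_left]
      exact fields_mul_mem _ hb
    | 2 =>
      obtain ⟨ξ, h⟩ := hD.apply_ghostPart_two ha
      rw [h, ι_ghost, show 2 + j - 1 = j + 1 by omega]
      exact ghost_mul_mem ξ hb
    | i + 3 =>
      rw [hD.apply_ghostPart_of_two_lt (by omega) ha, map_zero, zero_mul]
      exact zero_mem _

theorem coder_wedge_mem (hD : HasComponents d C D) (ξs : List Ξ) (s : SymmetricAlgebra k Φ) :
    GradedSym.coder (shiftedSpace k Ξ Φ) D (wedge ξs s) ∈ ghostPart k Ξ Φ (ξs.length - 1) := by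
  rw [coder_apply]
  exact hD.contract_mem (comul_wedge_mem ξs s)

end HasComponents

end Coderivation

/-! ### The identity `D ∘ D̄ = 0` -/

section Coderivation

variable {k Ξ Φ : Type*} [Field k]
  [AddCommGroup Ξ] [Module k Ξ] [AddCommGroup Φ] [Module k Φ]

namespace HasComponents

variable {d : Ξ →ₗ[k] (SymmetricAlgebra k Φ →ₗ[k] Φ)}
  {C : Ξ →ₗ[k] Ξ →ₗ[k] (SymmetricAlgebra k Φ →ₗ[k] Ξ)} {D : GaugeSym k Ξ Φ →ₗ[k] (Ξ × Φ)}

theorem apply_fields (hD : HasComponents d C D) (s : SymmetricAlgebra k Φ) :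
    D (fields k Ξ Φ s) = 0 := by
  simpa [wedge] using hD.none s

theorem apply_ghost_mul (hD : HasComponents d C D) (ξ : Ξ) (s : SymmetricAlgebra k Φ) :
    D (ghost k Φ ξ * fields k Ξ Φ s) = (0, d ξ s) := by
  simpa [wedge] using hD.one ξ s

theorem apply_ghost_mul_ghost_mul (hD : HasComponents d C D) (ξ η : Ξ)
    (s : SymmetricAlgebra k Φ) :
    D (ghost k Φ ξ * (ghost k Φ η * fields k Ξ Φ s)) = (C ξ η s, 0) := by
  simpa [wedge, mul_assoc] using hD.two ξ η s

theorem apply_ghost_mul_ghost_mul_ghost_mul (hD : HasComponents d C D) (ξ η ζ : Ξ)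
    (s : SymmetricAlgebra k Φ) :
    D (ghost k Φ ξ * (ghost k Φ η * (ghost k Φ ζ * fields k Ξ Φ s))) = 0 := by
  simpa [wedge, mul_assoc] using hD.many [ξ, η, ζ] s (by simp)

theorem ι_field_mul (φ : Φ) (z : GaugeSym k Ξ Φ) :
    GradedSym.ι (shiftedSpace k Ξ Φ) (0, φ) * z =
      fields k Ξ Φ (SymmetricAlgebra.ι k Φ φ) * z := by
  rw [fields_ι]

/-- Of the four ways to distribute `ξ`, `η` over the two tensor factors, both on the left gives
`δ̂(C(ξ, η))`, one on each side gives the two halves of the bracket, and both on the right gives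
`0`. -/
theorem apply_coder_two (hD : HasComponents d C D) (ξ η : Ξ) (s : SymmetricAlgebra k Φ) :
    D (GradedSym.coder (shiftedSpace k Ξ Φ) D (wedge [ξ, η] s)) =
      (0, conv (d ∘ₗ C ξ η) s - gerstenhaber (d ξ) (d η) s) := by
  -- Both sides are linear in the coproduct of `s`, so it may be replaced by a pure tensor.
  have key : ∀ t : SymmetricAlgebra k Φ ⊗[k] SymmetricAlgebra k Φ,
      D (contract D (GradedSym.primMul (shiftedSpace k Ξ Φ) (ξ, 0)
        (GradedSym.primMul (shiftedSpace k Ξ Φ) (η, 0)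
          (TensorProduct.map (fields k Ξ Φ).toLinearMap (fields k Ξ Φ).toLinearMap t)))) =
      (0, TensorProduct.lift (d ∘ₗ C ξ η) t -
        (d ξ (TensorProduct.lift (insertMul (d η)) t) -
          d η (TensorProduct.lift (insertMul (d ξ)) t))) := by
    intro t
    induction t with
    | zero => simp only [map_zero, sub_zero, Prod.mk_zero_zero]
    | tmul a b =>
      simp only [TensorProduct.map_tmul, AlgHom.toLinearMap_apply, primMul_ghost_tmul, map_add,
        map_mul, signHom_ghost, signHom_fields, koszul_neg_one, contract_tmul, map_smul,
        smul_mul_assoc, ← TensorProduct.smul_tmul', hD.apply_fields, hD.apply_ghost_mul,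
        hD.apply_ghost_mul_ghost_mul, ι_ghost, ι_field_mul, fields_mul_ghost_mul, map_zero, zero_mul]
      simp only [← map_mul, hD.apply_ghost_mul]
      simp [insertMul_apply]
      abel
    | add a b ha hb =>
      simp only [map_add, ha, hb]
      ext
      · simp
      · simp only [Prod.mk_add_mk]
        abel
  rw [coder_apply, comul_wedge_cons, comul_wedge_cons, wedge_nil, comul_fields, key]
  simp only [gerstenhaber, coder_eq_conv, LinearMap.sub_apply, LinearMap.comp_apply, conv_apply]

/-- One entry from `Ξ` on the left gives the terms with `coder`, two give the nested `C`; zero or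
three give `0`. The minus sign arises because bringing `η` alone, or `ξ` and `ζ`, to the front takes
one transposition in degree `-1`. -/
theorem apply_coder_three (hD : HasComponents d C D) (ξ η ζ : Ξ) (s : SymmetricAlgebra k Φ) :
    D (GradedSym.coder (shiftedSpace k Ξ Φ) D (wedge [ξ, η, ζ] s)) =
      ((C ξ η (coder (d ζ) s) + conv (C.flip ζ ∘ₗ C ξ η) s) +
      (C η ζ (coder (d ξ) s) + conv (C.flip ξ ∘ₗ C η ζ) s) -
      (C ξ ζ (coder (d η) s) + conv (C.flip η ∘ₗ C ξ ζ) s), 0) := by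
  have key : ∀ t : SymmetricAlgebra k Φ ⊗[k] SymmetricAlgebra k Φ,
      D (contract D (GradedSym.primMul (shiftedSpace k Ξ Φ) (ξ, 0)
        (GradedSym.primMul (shiftedSpace k Ξ Φ) (η, 0)
          (GradedSym.primMul (shiftedSpace k Ξ Φ) (ζ, 0)
            (TensorProduct.map (fields k Ξ Φ).toLinearMap (fields k Ξ Φ).toLinearMap t))))) =
      ((C ξ η (TensorProduct.lift (insertMul (d ζ)) t) +
          TensorProduct.lift (C.flip ζ ∘ₗ C ξ η) t) +
        (C η ζ (TensorProduct.lift (insertMul (d ξ)) t) +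
          TensorProduct.lift (C.flip ξ ∘ₗ C η ζ) t) -
        (C ξ ζ (TensorProduct.lift (insertMul (d η)) t) +
          TensorProduct.lift (C.flip η ∘ₗ C ξ ζ) t), 0) := by
    intro t
    induction t with
    | zero => simp only [map_zero, sub_zero, add_zero, Prod.mk_zero_zero]
    | tmul a b =>
      simp only [TensorProduct.map_tmul, AlgHom.toLinearMap_apply, primMul_ghost_tmul, map_add,
        map_mul, signHom_ghost, signHom_fields, koszul_neg_one, contract_tmul, map_smul,
        smul_mul_assoc, mul_smul_comm, ← TensorProduct.smul_tmul', hD.apply_fields, hD.apply_ghost_mul,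
        hD.apply_ghost_mul_ghost_mul, hD.apply_ghost_mul_ghost_mul_ghost_mul,
        ι_ghost, ι_field_mul, fields_mul_ghost_mul, map_zero, zero_mul]
      simp only [← map_mul, hD.apply_ghost_mul_ghost_mul]
      simp [insertMul_apply]
      abel
    | add a b ha hb =>
      simp only [map_add, ha, hb]
      ext
      · simp only [Prod.mk_add_mk]
        abel
      · simp
  rw [coder_apply, comul_wedge_cons, comul_wedge_cons, comul_wedge_cons, wedge_nil,
    comul_fields, key]
  simp only [coder_eq_conv, conv_apply]

theorem comp_coder (hD : HasComponents d C D)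
    (hC : ∀ ξ η, gerstenhaber (d ξ) (d η) = conv (d ∘ₗ C ξ η))
    (hd : ∀ π : SymmetricAlgebra k Φ →ₗ[k] Ξ, conv (d ∘ₗ π) = 0 → π = 0) :
    D ∘ₗ GradedSym.coder (shiftedSpace k Ξ Φ) D = 0 := by
  refine gaugeSym_hom_ext fun ξs s => ?_
  rw [LinearMap.comp_apply, LinearMap.zero_apply]
  have h := hD.coder_wedge_mem ξs s
  match ξs with
  | [] => exact hD.apply_ghostPart_zero h
  | [ξ] => exact hD.apply_ghostPart_zero h
  | [ξ, η] => rw [hD.apply_coder_two, hC, sub_self, Prod.mk_zero_zero]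
  | [ξ, η, ζ] =>
    -- Polarization of `C(ξ, ξ) = 0`; it reconciles the cyclic Jacobi sum with the unshuffle signs.
    have h_swap : C ζ ξ = -C ξ ζ := by
      have h_add := self_eq_zero_of_injective d C hC hd (ζ + ξ)
      simp only [map_add, LinearMap.add_apply, self_eq_zero_of_injective d C hC hd, zero_add,
        add_zero] at h_add
      exact eq_neg_of_add_eq_zero_right h_add
    have h_jacobi := congr($(jacobi_of_injective d C hC hd ξ η ζ) s)
    rw [h_swap, LinearMap.comp_neg, LinearMap.neg_comp, LinearMap.map_neg conv] at h_jacobi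
    simp only [LinearMap.add_apply, LinearMap.neg_apply, LinearMap.comp_apply,
      LinearMap.zero_apply] at h_jacobi
    rw [hD.apply_coder_three]
    refine Prod.ext ?_ rfl
    rw [← h_jacobi.trans Prod.fst_zero.symm]
    abel_nf
  | ξ :: η :: ζ :: χ :: ξs => exact hD.apply_ghostPart_of_two_lt (by simp) h

end HasComponents

end Coderivation

/-! ### Assembling the sh-Lie structure -/

section GaugeMap

variable {k A Ξ Φ : Type*} [Field k] [CommRing A] [Algebra k A]
  [AddCommGroup Ξ] [Module k Ξ]
  [AddCommGroup Φ] [Module k Φ] [Module A Φ] [IsScalarTower k A Φ]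

/-- Products of fields span `Λ*Φ`, so formulas on lists of fields extend to all `s`. The clause
`single` is the case of the empty product, since `∂(ξ) = δ(ξ)(1)`. -/
theorem isGaugeMap_iff (δ : Ξ →ₗ[k] (SymmetricAlgebra A Φ →ₗ[A] Φ))
    (C : Ξ →ₗ[k] Ξ →ₗ[k] (SymmetricAlgebra k Φ →ₗ[k] Ξ)) (D : GaugeSym k Ξ Φ →ₗ[k] (Ξ × Φ)) :
    IsGaugeMap δ C D ↔ HasComponents (toBase ∘ₗ δ) C D := by
  constructor
  · intro h
    have ext_wedge : ∀ (ξs : List Ξ) (f : SymmetricAlgebra k Φ →ₗ[k] (Ξ × Φ)),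
        (∀ φs : List Φ, D (gaugeWedge k ξs φs) = f (φs.map (SymmetricAlgebra.ι k Φ)).prod) →
        ∀ s, D (wedge ξs s) = f s := by
      intro ξs f hf s
      have : D ∘ₗ LinearMap.mulLeft k (ξs.map (ghost k Φ)).prod ∘ₗ
          (fields k Ξ Φ).toLinearMap = f := by
        refine symmetricAlgebra_hom_ext fun φs => ?_
        rw [← hf, gaugeWedge_eq_wedge]
        rfl
      exact congr($this s)
    refine ⟨?_, fun ξ => ?_, fun ξ η => ?_, fun ξs s hξs => ?_⟩
    · exact ext_wedge [] 0 h.none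
    · refine ext_wedge [ξ] (LinearMap.inr k Ξ Φ ∘ₗ toBase (δ ξ)) fun φs => ?_
      by_cases hφs : φs = []
      · subst hφs
        exact h.single ξ
      · rw [h.one ξ φs hφs, ← changeBase_prod (k := k)]
        rfl
    · exact ext_wedge [ξ, η] (LinearMap.inl k Ξ Φ ∘ₗ C ξ η) (h.two ξ η)
    · exact ext_wedge ξs 0 (fun φs => h.many ξs φs hξs) s
  · intro h
    refine ⟨fun φs => ?_, fun ξ => ?_, fun ξ φs _ => ?_, fun ξ η φs => ?_, fun ξs φs hξs => ?_⟩
    · rw [gaugeWedge_eq_wedge, h.none]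
    · rw [gaugeWedge_eq_wedge, h.one]
      rfl
    · rw [gaugeWedge_eq_wedge, h.one, ← changeBase_prod (k := k) (A := A)]
      rfl
    · rw [gaugeWedge_eq_wedge, h.two]
    · rw [gaugeWedge_eq_wedge, h.many _ _ hξs]

theorem gaugeDiff_mem (δ : Ξ →ₗ[k] (SymmetricAlgebra A Φ →ₗ[A] Φ)) (n : ℤ) (x : Ξ × Φ)
    (hx : x ∈ gaugeSpace k Ξ Φ n) : gaugeDiff δ x ∈ gaugeSpace k Ξ Φ (n + 1) := by
  -- Degree `m + 1` of `L` is degree `m` of `↓L`, so the case split for `↓L` applies.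
  obtain ⟨m, rfl⟩ : ∃ m : ℤ, n = m + 1 := ⟨n - 1, by omega⟩
  rcases mem_shiftedSpace (i := m) hx with ⟨rfl, ξ, rfl⟩ | ⟨rfl, φ, rfl⟩ | rfl
  · exact inr_mem_gaugeSpace _
  · have : gaugeDiff δ ((0 : Ξ), φ) = 0 := by simp [gaugeDiff]
    rw [this]
    exact zero_mem _
  · rw [map_zero]
    exact zero_mem _

theorem gaugeDiff_comp_self (δ : Ξ →ₗ[k] (SymmetricAlgebra A Φ →ₗ[A] Φ)) :
    gaugeDiff δ ∘ₗ gaugeDiff δ = 0 := by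
  ext x <;> simp [gaugeDiff]

theorem HasComponents.isShLie {δ : Ξ →ₗ[k] (SymmetricAlgebra A Φ →ₗ[A] Φ)}
    {C : Ξ →ₗ[k] Ξ →ₗ[k] (SymmetricAlgebra k Φ →ₗ[k] Ξ)} {D : GaugeSym k Ξ Φ →ₗ[k] (Ξ × Φ)}
    (hD : HasComponents (toBase ∘ₗ δ) C D)
    (hC : ∀ ξ η, gerstenhaber (toBase (δ ξ)) (toBase (δ η)) = conv ((toBase ∘ₗ δ) ∘ₗ C ξ η))
    (hd : ∀ π : SymmetricAlgebra k Φ →ₗ[k] Ξ, conv ((toBase ∘ₗ δ) ∘ₗ π) = 0 → π = 0) :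
    IsShLie (gaugeSpace k Ξ Φ) (gaugeDiff δ) D where
  d_degree := gaugeDiff_mem δ
  d_comp_d := gaugeDiff_comp_self δ
  degree _ _ hz := hD.apply_degreePart hz
  map_one := by
    rw [← map_one (fields k Ξ Φ)]
    exact hD.apply_fields 1
  map_ι x := by
    obtain ⟨ξ, φ⟩ := x
    have hx : ((ξ, φ) : Ξ × Φ) = (ξ, 0) + (0, φ) := by simp
    have h := hD.apply_ghost_mul ξ 1
    rw [map_one, mul_one] at h
    rw [hx, map_add, map_add, ι_ghost, ← fields_ι, hD.apply_fields, h, map_add]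
    simp [gaugeDiff]
  comp_coder := hD.comp_coder hC hd

end GaugeMap

end ShLie

end

theorem theorem2 {k A Ξ Φ : Type*} [Field k] [CharZero k] [CommRing A] [Algebra k A]
    [AddCommGroup Ξ] [Module k Ξ]
    [AddCommGroup Φ] [Module k Φ] [Module A Φ] [IsScalarTower k A Φ]
    (δ : Ξ →ₗ[k] (SymmetricAlgebra A Φ →ₗ[A] Φ))
    (C : Ξ →ₗ[k] Ξ →ₗ[k] (SymmetricAlgebra k Φ →ₗ[k] Ξ))
    (hC : ShLie.BBvD δ C)
    (hδ : Function.Injective (ShLie.hatDelta δ)) :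
    ∃ D : ShLie.GradedSym (ShLie.desusp (ShLie.gaugeSpace k Ξ Φ)) →ₗ[k] (Ξ × Φ),
      ShLie.IsGaugeMap δ C D ∧
      (∀ D', ShLie.IsGaugeMap δ C D' → D' = D) ∧
      ShLie.IsShLie (ShLie.gaugeSpace k Ξ Φ) (ShLie.gaugeDiff δ) D := by
  have hC' : ∀ ξ η, ShLie.gerstenhaber (ShLie.toBase (δ ξ)) (ShLie.toBase (δ η)) =
      ShLie.conv ((ShLie.toBase ∘ₗ δ) ∘ₗ C ξ η) := fun ξ η => by
    rw [← ShLie.toBase_gerstenhaber, hC ξ η, ShLie.hatDelta_apply]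
  have hd : ∀ π : SymmetricAlgebra k Φ →ₗ[k] Ξ,
      ShLie.conv ((ShLie.toBase ∘ₗ δ) ∘ₗ π) = 0 → π = 0 := fun π hπ =>
    hδ (by rw [map_zero, ShLie.hatDelta_apply, hπ])
  obtain ⟨D, hD⟩ := ShLie.exists_hasComponents (ShLie.toBase ∘ₗ δ) C
    (ShLie.self_eq_zero_of_injective _ C hC' hd)
  exact ⟨D, (ShLie.isGaugeMap_iff δ C D).2 hD,
    fun D' hD' => hD.unique ((ShLie.isGaugeMap_iff δ C D').1 hD'), hD.isShLie hC' hd⟩
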